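/- Let $T,M>0$, $r\in\mathbb R$, and let $W$ be a $d$-dimensional Brownian motion for a filtration $\mathcal F$, with standard components and positive definite correlation matrix $R$. Let $\mu:[0,T]\to\mathbb R^d$ and $\sigma:[0,T]\to\mathbb R^{d\times d}$ be deterministic and continuous, each $\sigma_t$ symmetric and positive definite with positive entries. A control $u=(u^1,\dots,u^d)$ is an adapted càglàd process with $|u^i|\le M$ for all $i$; under $u$, the wealth started at time $t$ in $x$ solves, on $[t,T]$, $$dX^u_s=\Big[rX^u_s+\sum_i u^i_s(\mu^i_s-r)\Big]ds+\sum_{i,j}u^i_s\sigma^{ij}_s\,dW^j_s,\qquad X^u_t=x .$$ Let $\mathcal T(x)=\frac1\beta(1-e^{-\gamma x})$ with $\beta,\gamma>0$, let $\lambda:[0,T]\to[0,\infty)$ be continuous, $F:\mathbb R\to\mathbb R$ be $C^1$, non-decreasing and convex, with $F(+\infty):=\sup F$, and let $\rho$, with values in $\mathbb R\cup\{+\infty\}$ on the square integrable $\mathcal F_T$-measurable random variables, be law-invariant, positively homogeneous, and either cash-invariant ($\rho(Y+m)=\rho(Y)-m$) or shift-invariant ($\rho(Y+m)=\rho(Y)$).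 Assume that $\varrho$, the value of $\rho$ at the standard normal law, is finite. Put $$J(t,x,u)=\mathbb E_{t,x}\big[\mathcal T(X^u_T-xe^{r(T-t)})\big]-\lambda_tF\big(\rho_{t,x}(X^u_T-xe^{r(T-t)})\big),$$ where the subscript $t,x$ means that the wealth starts at time $t$ in $x$ (and $\rho_{t,x}$ is $\rho$ evaluated at the resulting law). A control $\hat u$ is optimal (a Nash equilibrium) against a class $\mathcal V$ of controls if $\liminf_{h\downarrow0}\frac{J(t,x,\hat u)-J(t,x,u_h)}{h}\ge0$ for all $t\in[0,T)$, $x\in\mathbb R$, $u\in\mathcal V$, where $u_h=u$ on $[t,t+h)$ and $u_h=\hat u$ on $[t+h,T]$. Write $\langle x,y\rangle_R=x^TRy$, let $\sigma^{k\cdot}$ be the $k$-th row of $\sigma$, and let $\mathbb 1_\rho$ be $1$ if $\rho$ is cash-invariant and $0$ otherwise. Let $\hat u:[0,T]\to[-M,M]^d$ be deterministic and continuous, and put $$A_t=\int_t^T\hat u_s^T(\mu_s-r)e^{r(T-s)}ds,\qquad B_t=\Big(\int_t^T\langle\hat u_s^T\sigma_se^{r(T-s)},\hat u_s^T\sigma_se^{r(T-s)}\rangle_R\,ds\Big)^{1/2}.$$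 For $t\in[0,T)$ with $B_t>0$ and $k\in\{1,\dots,d\}$ consider the equation for $w\in\mathbb R^d$ $$\begin{aligned}0=&-\frac1\beta e^{-\gamma A_t+\frac{\gamma^2}2B_t^2}\Big(-\gamma(\mu^k_t-r)e^{r(T-t)}+\gamma^2\langle w^T\sigma_te^{r(T-t)},\sigma^{k\cdot}_te^{r(T-t)}\rangle_R\Big)\\&-\lambda_tF'\big(-\mathbb 1_\rho A_t+\varrho B_t\big)\Big(-\mathbb 1_\rho(\mu^k_t-r)e^{r(T-t)}+\varrho\,\frac{\langle w^T\sigma_te^{r(T-t)},\sigma^{k\cdot}_te^{r(T-t)}\rangle_R}{B_t}\Big),\end{aligned}\tag{$E^k_t$}$$ in which $A_t$ and $B_t$ depend only on $\hat u$ on $(t,T]$. 1. If $\hat u$ is optimal against all controls (or only against a class of controls that contains the deterministic ones), then for every $t\in[0,T)$ with $B_t>0$ and every $k$ with $|\hat u^k_t|<M$, the equation $(E^k_t)$ holds with $w=\hat u_t$. 2. If $\varrho\ge0$, then for every $t\in[0,T)$ with $B_t>0$ the system $(E^k_t)$, $k=1,\dots,d$, has at most one solution $w$. 3. If $\varrho\ge0$,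 $B_t>0$ for all $t\in[0,T)$, and $w=\hat u_t$ solves $(E^k_t)$ for all $t\in[0,T)$ and all $k$, then $\hat u$ is optimal against all deterministic controls. -/

import Mathlib

open MeasureTheory ProbabilityTheory Filter Set
open scoped Topology Matrix

namespace TimeConsistent

/-- A Black–Scholes market with `d` risky assets on `[0, T]`: short rate `r`, deterministic
continuous drift `μ` and volatility `σ`, correlation matrix `R` of the driving Brownian motion,
and the bound `M` on the amount invested in each asset. -/
structure Market (d : ℕ) where
  T : ℝ
  T_pos : 0 < T
  M : ℝ
  M_pos : 0 < M
  r : ℝ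
  μ : ℝ → Fin d → ℝ
  μ_cont : ContinuousOn μ (Icc 0 T)
  σ : ℝ → Matrix (Fin d) (Fin d) ℝ
  σ_cont : ContinuousOn σ (Icc 0 T)
  σ_pos : ∀ t ∈ Icc 0 T, ∀ i j, 0 < σ t i j
  σ_symm : ∀ t ∈ Icc 0 T, (σ t).IsSymm
  σ_posDef : ∀ t ∈ Icc 0 T, (σ t).PosDef
  R : Matrix (Fin d) (Fin d) ℝ
  R_posDef : R.PosDef
  R_diag : ∀ j, R j j = 1

section Probability

variable {Ω : Type*} [mΩ : MeasurableSpace Ω] {d : ℕ}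

/-- `W` is a `d`-dimensional Brownian motion for the filtration `ℱ`, with standard components and
correlation matrix `R` (as `R j j = 1`): increments over `[s, t]` are independent of `ℱ s` and
centred Gaussian with covariance matrix `(t - s) R`. The latter is expressed through the laws of
all linear combinations of the components. Only times `≥ 0` matter. -/
structure IsBrownianMotion (P : Measure Ω) (ℱ : Filtration ℝ mΩ)
    (R : Matrix (Fin d) (Fin d) ℝ) (W : ℝ → Ω → Fin d → ℝ) : Prop where
  adapted : ∀ t, 0 ≤ t → Measurable[ℱ t] (W t)
  zero : ∀ᵐ ω ∂P, W 0 ω = 0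
  continuous_paths : ∀ᵐ ω ∂P, ContinuousOn (fun t => W t ω) (Ici 0)
  indep_increments : ∀ s t, 0 ≤ s → s ≤ t →
    Indep (MeasurableSpace.comap (fun ω => W t ω - W s ω) inferInstance) (ℱ s) P
  law_increments : ∀ s t, 0 ≤ s → s ≤ t → ∀ a : Fin d → ℝ,
    P.map (fun ω => a ⬝ᵥ (W t ω - W s ω)) =
      gaussianReal 0 (Real.toNNReal ((t - s) * (a ⬝ᵥ (R *ᵥ a))))

/-- `I` is (a version of) the Itô integral `∑ⱼ ∫ₐᵇ Hʲ dWʲ`: the limit in probability of the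
left-endpoint Riemann sums along the equidistant partitions of `[a, b]`. For bounded adapted
integrands whose paths have one-sided limits (the only ones used below) this limit exists and is
the Itô integral. -/
def IsItoIntegral (P : Measure Ω) (W H : ℝ → Ω → Fin d → ℝ) (a b : ℝ) (I : Ω → ℝ) : Prop :=
  TendstoInMeasure P
    (fun (n : ℕ) ω => ∑ i ∈ Finset.range n,
      H (a + i * ((b - a) / n)) ω ⬝ᵥ
        (W (a + (i + 1) * ((b - a) / n)) ω - W (a + i * ((b - a) / n)) ω))
    atTop I

/-- `X` is the wealth process on `[t, T]` started in `x` at time `t` under the control `u`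
(`u s ω i` is the amount invested in asset `i`), i.e. a solution of
`dXₛ = [r Xₛ + ∑ᵢ uⁱₛ (μⁱₛ - r)] ds + ∑ᵢⱼ uⁱₛ σⁱʲₛ dWʲₛ`, `Xₜ = x`. Working with this process is
working under the conditional expectation `𝔼_{t,x}`. -/
structure IsWealth (mk : Market d) (P : Measure Ω) (ℱ : Filtration ℝ mΩ)
    (W : ℝ → Ω → Fin d → ℝ) (u : ℝ → Ω → Fin d → ℝ) (t x : ℝ) (X : ℝ → Ω → ℝ) : Prop where
  adapted : ∀ s ∈ Icc t mk.T, Measurable[ℱ s] (X s)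
  measurable : Measurable (Function.uncurry X)
  integrable_paths : ∀ᵐ ω ∂P, IntervalIntegrable (fun s => X s ω) volume t mk.T
  initial : ∀ᵐ ω ∂P, X t ω = x
  sde : ∀ s ∈ Icc t mk.T,
    IsItoIntegral P W (fun q ω => u q ω ᵥ* mk.σ q) t s
      (fun ω => X s ω - x -
        ∫ q in t..s, (mk.r * X q ω + ∑ i, u q ω i * (mk.μ q i - mk.r)))

/-- Left-continuous with right limits on `[0, T]`. -/
def IsCaglad (T : ℝ) (f : ℝ → ℝ) : Prop :=
  (∀ s ∈ Ioc 0 T, Tendsto f (𝓝[<] s) (𝓝 (f s))) ∧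
    ∀ s ∈ Ico 0 T, ∃ l, Tendsto f (𝓝[>] s) (𝓝 l)

/-- The control space: adapted processes with càglàd paths, each component bounded by `M`. -/
def admissibleControls (mk : Market d) (ℱ : Filtration ℝ mΩ) : Set (ℝ → Ω → Fin d → ℝ) :=
  {u | (∀ s ∈ Icc 0 mk.T, Measurable[ℱ s] (u s)) ∧
    (∀ ω i, IsCaglad mk.T (fun s => u s ω i)) ∧
    ∀ s ∈ Icc 0 mk.T, ∀ ω i, |u s ω i| ≤ mk.M}

/-- The admissible controls that do not depend on chance. -/
def deterministicControls (mk : Market d) (ℱ : Filtration ℝ mΩ) : Set (ℝ → Ω → Fin d → ℝ) :=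
  {u | u ∈ admissibleControls mk ℱ ∧ ∃ v : ℝ → Fin d → ℝ, ∀ s ω, u s ω = v s}

/-- The square integrable positions that are known at time `T`. -/
def SqIntegrable (P : Measure Ω) (ℱ : Filtration ℝ mΩ) (T : ℝ) (Y : Ω → ℝ) : Prop :=
  Measurable[ℱ T] Y ∧ MemLp Y 2 P

/-- A law-invariant, positively homogeneous risk measure with values in `ℝ ∪ {+∞}` on the square
integrable `ℱ T`-measurable positions (its values elsewhere are irrelevant). -/
structure RiskMeasure (P : Measure Ω) (ℱ : Filtration ℝ mΩ) (T : ℝ) where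
  toFun : (Ω → ℝ) → EReal
  ne_bot : ∀ Y, SqIntegrable P ℱ T Y → toFun Y ≠ ⊥
  law_invariant : ∀ Y Z, SqIntegrable P ℱ T Y → SqIntegrable P ℱ T Z →
    P.map Y = P.map Z → toFun Y = toFun Z
  pos_homogeneous : ∀ Y, SqIntegrable P ℱ T Y → ∀ b : ℝ, 0 ≤ b →
    toFun (fun ω => b * Y ω) = (b : EReal) * toFun Y

namespace RiskMeasure

variable {P : Measure Ω} {ℱ : Filtration ℝ mΩ} {T : ℝ}

def CashInvariant (ρ : RiskMeasure P ℱ T) : Prop :=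
  ∀ Y, SqIntegrable P ℱ T Y → ∀ c : ℝ, ρ.toFun (fun ω => Y ω + c) = ρ.toFun Y - (c : EReal)

def ShiftInvariant (ρ : RiskMeasure P ℱ T) : Prop :=
  ∀ Y, SqIntegrable P ℱ T Y → ∀ c : ℝ, ρ.toFun (fun ω => Y ω + c) = ρ.toFun Y

open Classical in
/-- The indicator of cash-invariance. -/
noncomputable def cashInd (ρ : RiskMeasure P ℱ T) : ℝ := if ρ.CashInvariant then 1 else 0

open Classical in
/-- The risk measure as a function of the law: the common value on all positions with law `ν`. -/
noncomputable def onLaw (ρ : RiskMeasure P ℱ T) (ν : Measure ℝ) : EReal :=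
  if h : ∃ Y, SqIntegrable P ℱ T Y ∧ P.map Y = ν then ρ.toFun h.choose else ⊤

theorem onLaw_map (ρ : RiskMeasure P ℱ T) {Y : Ω → ℝ} (hY : SqIntegrable P ℱ T Y) :
    ρ.onLaw (P.map Y) = ρ.toFun Y := by
  have h : ∃ Z, SqIntegrable P ℱ T Z ∧ P.map Z = P.map Y := ⟨Y, hY, rfl⟩
  unfold onLaw
  rw [dif_pos h]
  exact ρ.law_invariant _ _ h.choose_spec.1 hY h.choose_spec.2

/-- The risk of a standard normal position, i.e. of a component of the Brownian motion at time
`1`. -/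
noncomputable def normalRisk (ρ : RiskMeasure P ℱ T) : EReal := ρ.onLaw (gaussianReal 0 1)

end RiskMeasure

/-- A function `F : ℝ → ℝ` evaluated on `ℝ ∪ {+∞}`, with `F(+∞) = sup F` (`F` is
non-decreasing). -/
noncomputable def extend (F : ℝ → ℝ) (y : EReal) : EReal :=
  if y = ⊤ then ⨆ a : ℝ, (F a : EReal) else (F y.toReal : EReal)

/-- The reward
`𝔼_{t,x}[𝒯(X_T - x e^{r(T-t)})] - λₜ F(ρ_{t,x}(X_T - x e^{r(T-t)}))`
of the wealth process `X` started in `x` at time `t`. -/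
noncomputable def reward (mk : Market d) (P : Measure Ω) {ℱ : Filtration ℝ mΩ}
    (ρ : RiskMeasure P ℱ mk.T) (𝒯 F lam : ℝ → ℝ) (t x : ℝ) (X : ℝ → Ω → ℝ) : EReal :=
  ((∫ ω, 𝒯 (X mk.T ω - x * Real.exp (mk.r * (mk.T - t))) ∂P : ℝ) : EReal) -
    (lam t : EReal) *
      extend F (ρ.toFun fun ω => X mk.T ω - x * Real.exp (mk.r * (mk.T - t)))

/-- The control that follows `u` before time `t + h` and `û` from then on. -/
noncomputable def splice (û u : ℝ → Ω → Fin d → ℝ) (t h : ℝ) : ℝ → Ω → Fin d → ℝ :=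
  fun s ω => if s < t + h then u s ω else û s ω

/-- `û` is a Nash equilibrium control law against the controls in `𝒱`: for every `(t, x)` and
every `u ∈ 𝒱`, `liminf_{h ↓ 0} (J(t, x, û) - J(t, x, u_h)) / h ≥ 0`, where `u_h` follows `u` on
`[t, t + h)` and `û` on `[t + h, T]`. The rewards are those of any versions of the wealth
processes. -/
def IsNashEquilibrium (mk : Market d) (P : Measure Ω) (ℱ : Filtration ℝ mΩ)
    (W : ℝ → Ω → Fin d → ℝ) (ρ : RiskMeasure P ℱ mk.T) (𝒯 F lam : ℝ → ℝ)
    (𝒱 : Set (ℝ → Ω → Fin d → ℝ)) (û : ℝ → Ω → Fin d → ℝ) : Prop :=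
  û ∈ admissibleControls mk ℱ ∧
    ∀ t ∈ Ico 0 mk.T, ∀ x : ℝ, ∀ u ∈ 𝒱,
      ∀ X : ℝ → Ω → ℝ, IsWealth mk P ℱ W û t x X →
      ∀ Xh : ℝ → ℝ → Ω → ℝ,
        (∀ h ∈ Ioc 0 (mk.T - t), IsWealth mk P ℱ W (splice û u t h) t x (Xh h)) →
        0 ≤ liminf
          (fun h : ℝ =>
            (reward mk P ρ 𝒯 F lam t x X - reward mk P ρ 𝒯 F lam t x (Xh h)) / (h : EReal))
          (𝓝[>] 0)

end Probability

section Equation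

variable {d : ℕ}

/-- The exponential target function `x ↦ (1 - e^{-γx}) / β`. -/
noncomputable def expTarget (β γ : ℝ) (x : ℝ) : ℝ := 1 / β * (1 - Real.exp (-γ * x))

/-- The bilinear form `⟨x, y⟩_R = xᵀ R y`. -/
def innerR (R : Matrix (Fin d) (Fin d) ℝ) (x y : Fin d → ℝ) : ℝ := x ⬝ᵥ (R *ᵥ y)

/-- The excess drift `(μᵏₛ - r) e^{r(T-s)}`. -/
noncomputable def excess (mk : Market d) (s : ℝ) (k : Fin d) : ℝ :=
  (mk.μ s k - mk.r) * Real.exp (mk.r * (mk.T - s))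

/-- The row vector `wᵀ σₛ e^{r(T-s)}`. -/
noncomputable def volVec (mk : Market d) (s : ℝ) (w : Fin d → ℝ) : Fin d → ℝ :=
  Real.exp (mk.r * (mk.T - s)) • (w ᵥ* mk.σ s)

/-- The row vector `σₛ^{k·} e^{r(T-s)}`. -/
noncomputable def volRow (mk : Market d) (s : ℝ) (k : Fin d) : Fin d → ℝ :=
  Real.exp (mk.r * (mk.T - s)) • mk.σ s k

/-- `∫ₜᵀ ûₛᵀ (μₛ - r) e^{r(T-s)} ds`. -/
noncomputable def driftInt (mk : Market d) (û : ℝ → Fin d → ℝ) (t : ℝ) : ℝ :=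
  ∫ s in t..mk.T, ∑ i, û s i * excess mk s i

/-- `‖ûₛᵀ σₛ e^{r(T-s)}‖` in `L²((t, T], ds; H)`, with `H = (ℝᵈ, ⟨·,·⟩_R)`. -/
noncomputable def volNorm (mk : Market d) (û : ℝ → Fin d → ℝ) (t : ℝ) : ℝ :=
  Real.sqrt (∫ s in t..mk.T, innerR mk.R (volVec mk s (û s)) (volVec mk s (û s)))

/-- The right-hand side of the `k`-th equation at time `t`, for the current value `w` of the
control and its values `û` on `(t, T]`. Here `c` is the indicator of cash-invariance (so that
`∫ₜᵀ mₛ(û) ds = c * driftInt`) and `ϱ` the risk of a standard normal position. -/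
noncomputable def firstOrder (mk : Market d) (β γ : ℝ) (F lam : ℝ → ℝ) (c ϱ : ℝ)
    (û : ℝ → Fin d → ℝ) (t : ℝ) (w : Fin d → ℝ) (k : Fin d) : ℝ :=
  -(1 / β) * Real.exp (-γ * driftInt mk û t + γ ^ 2 / 2 * volNorm mk û t ^ 2) *
      (-γ * excess mk t k + γ ^ 2 * innerR mk.R (volVec mk t w) (volRow mk t k)) -
    lam t * deriv F (-(c * driftInt mk û t) + ϱ * volNorm mk û t) *
      (-(c * excess mk t k) +
        ϱ * (innerR mk.R (volVec mk t w) (volRow mk t k) / volNorm mk û t))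

end Equation

end TimeConsistent

open TimeConsistent

/-!
# Equilibrium controls under an exponential target and a risk penalty

Under a deterministic control the gain `X_T - x e^{r(T-t)}` is Gaussian, with mean `driftInt` and
variance `volNorm²` (`IsWealth.map_terminal`). A law-invariant, positively homogeneous and cash- or
shift-invariant risk measure is affine on nondegenerate Gaussian positions, so the reward is an
explicit function of these two integrals (`reward_eq_gaussianReward`). Following `u` instead of `û`
on `[t, t + h)` changes both integrals by an integral over `[t, t + h]`; hence the quotient
`(J(û) - J(u_h)) / h` converges, and its limit is a linear form in `w - û t`, with the first-order
expressions as coefficients, plus a quadratic form in `w - û t`, where `w` is the right limit of `u`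
at `t` (`tendsto_reward_quotient`). For `ϱ ≥ 0` the quadratic form is nonnegative
(`curvature_pos`).

* If `û` is an equilibrium, small constant deviations `w = û t + ε eₖ` of both signs force the
  coefficient of `ε` to vanish (`firstOrder_eq_zero_of_isNash`).
* The first-order system is affine in `w` with a definite linear part, hence has at most one
  solution (`firstOrder_unique`).
* If `û` solves the system, only the quadratic form is left in the limit (`isNash_of_firstOrder`).

The stochastic part rests on a construction of the Itô integral for deterministic integrands.
Step integrands satisfy the isometry (`StepIntegrand.integral_mul_integral`) and have Gaussian
integrals; bounded almost everywhere convergence of the integrands carries both over to the limit in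
`L²` (`IsWienerIntegral.integral_mul`, `IsWienerIntegral.map_eq`). The wealth equation is linear, so
pathwise integration by parts expresses the terminal wealth as a time average of the Itô integral
in the equation. A stochastic Fubini theorem (`isWienerIntegral_average`) identifies this average
with the Wiener integral of `vₛᵀ σₛ e^{r(T-s)}`. That an equilibrium solves the equations also needs
the existence of wealth processes (`exists_isWealth`): the truncated Riemann sums converge in `L²`
uniformly in the upper limit, so one subsequence converges almost surely at every time, and its
upper limit is progressively measurable; variation of constants then solves the equation.
-/

namespace TimeConsistent

/-! ### The bilinear form `⟨x, y⟩_R` -/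

section InnerR

variable {d : ℕ} {R : Matrix (Fin d) (Fin d) ℝ}

theorem innerR_add_left (x y z : Fin d → ℝ) :
    innerR R (x + y) z = innerR R x z + innerR R y z := by
  simp [innerR, add_dotProduct]

theorem innerR_add_right (x y z : Fin d → ℝ) :
    innerR R x (y + z) = innerR R x y + innerR R x z := by
  simp [innerR, Matrix.mulVec_add, dotProduct_add]

theorem innerR_smul_left (c : ℝ) (x y : Fin d → ℝ) :
    innerR R (c • x) y = c * innerR R x y := by
  simp [innerR]

theorem innerR_smul_right (c : ℝ) (x y : Fin d → ℝ) :
    innerR R x (c • y) = c * innerR R x y := by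
  simp [innerR, Matrix.mulVec_smul]

theorem innerR_zero_left (x : Fin d → ℝ) : innerR R 0 x = 0 := by simp [innerR]

theorem innerR_zero_right (x : Fin d → ℝ) : innerR R x 0 = 0 := by simp [innerR]

theorem innerR_sub_left (x y z : Fin d → ℝ) :
    innerR R (x - y) z = innerR R x z - innerR R y z := by
  simp [innerR, sub_dotProduct]

theorem innerR_sub_right (x y z : Fin d → ℝ) :
    innerR R x (y - z) = innerR R x y - innerR R x z := by
  simp [innerR, Matrix.mulVec_sub, dotProduct_sub]

theorem innerR_sum_left {ι : Type*} (s : Finset ι) (f : ι → Fin d → ℝ) (y : Fin d → ℝ) :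
    innerR R (∑ i ∈ s, f i) y = ∑ i ∈ s, innerR R (f i) y := by
  simp [innerR, sum_dotProduct]

theorem innerR_sum_right {ι : Type*} (s : Finset ι) (f : ι → Fin d → ℝ) (x : Fin d → ℝ) :
    innerR R x (∑ i ∈ s, f i) = ∑ i ∈ s, innerR R x (f i) := by
  classical
  induction s using Finset.induction_on with
  | empty => simp [innerR_zero_right]
  | insert a s ha ih => rw [Finset.sum_insert ha, innerR_add_right, ih, Finset.sum_insert ha]

theorem innerR_comm (hR : R.PosDef) (x y : Fin d → ℝ) : innerR R x y = innerR R y x := by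
  have h : Rᵀ = R := by simpa using hR.isHermitian.eq
  unfold innerR
  rw [Matrix.dotProduct_mulVec, ← Matrix.mulVec_transpose, h, dotProduct_comm]

theorem innerR_self_nonneg (hR : R.PosDef) (x : Fin d → ℝ) : 0 ≤ innerR R x x := by
  simpa [innerR] using hR.posSemidef.dotProduct_mulVec_nonneg x

theorem innerR_self_eq_zero (hR : R.PosDef) {x : Fin d → ℝ} (h : innerR R x x = 0) : x = 0 := by
  by_contra hx
  have := hR.dotProduct_mulVec_pos hx
  simp only [star_trivial] at this
  exact this.ne' h

theorem continuous_innerR : Continuous fun p : (Fin d → ℝ) × (Fin d → ℝ) => innerR R p.1 p.2 := by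
  unfold innerR
  fun_prop

theorem abs_innerR_le {x y : Fin d → ℝ} {C C' : ℝ} (hx : ∀ i, |x i| ≤ C) (hy : ∀ i, |y i| ≤ C') :
    |innerR R x y| ≤ (∑ i, ∑ j, |R i j|) * (C * C') := by
  simp only [innerR, dotProduct, Matrix.mulVec, Finset.mul_sum, Finset.sum_mul]
  refine (Finset.abs_sum_le_sum_abs _ _).trans (Finset.sum_le_sum fun i _ => ?_)
  refine (Finset.abs_sum_le_sum_abs _ _).trans (Finset.sum_le_sum fun j _ => ?_)
  have h1 := hx i
  have h2 := hy j
  have h3 : 0 ≤ C := (abs_nonneg _).trans h1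
  rw [abs_mul, abs_mul]
  calc |x i| * (|R i j| * |y j|) = |R i j| * (|x i| * |y j|) := by ring
    _ ≤ |R i j| * (C * C') := by gcongr

/-- Expansion of the square `⟨x, x⟩_R` around `y`. -/
theorem innerR_self_sub (hR : R.PosDef) (x y : Fin d → ℝ) :
    innerR R x x - innerR R y y = 2 * innerR R y (x - y) + innerR R (x - y) (x - y) := by
  simp only [innerR_sub_left, innerR_sub_right]
  rw [innerR_comm hR x y]
  ring

end InnerR

/-! ### Moments of the Brownian motion -/

section Brownian

variable {Ω : Type*} {d : ℕ}

theorem measurable_dotProduct_left {m : MeasurableSpace Ω} {f : Ω → Fin d → ℝ}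
    (hf : Measurable f) (a : Fin d → ℝ) : Measurable fun ω => a ⬝ᵥ f ω :=
  (by fun_prop : Measurable fun v : Fin d → ℝ => a ⬝ᵥ v).comp hf

variable [mΩ : MeasurableSpace Ω] {P : Measure Ω} {ℱ : Filtration ℝ mΩ}
  {R : Matrix (Fin d) (Fin d) ℝ} {W : ℝ → Ω → Fin d → ℝ}

namespace IsBrownianMotion

theorem measurable_increment_le (hW : IsBrownianMotion P ℱ R W) {s t u : ℝ} (hs : 0 ≤ s)
    (hst : s ≤ t) (htu : t ≤ u) (a : Fin d → ℝ) :
    Measurable[ℱ u] fun ω => a ⬝ᵥ (W t ω - W s ω) :=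
  measurable_dotProduct_left (m := ℱ u)
    (((hW.adapted t (hs.trans hst)).mono (ℱ.mono htu) le_rfl).sub
      ((hW.adapted s hs).mono (ℱ.mono (hst.trans htu)) le_rfl)) a

theorem measurable_increment (hW : IsBrownianMotion P ℱ R W) {s t : ℝ} (hs : 0 ≤ s)
    (hst : s ≤ t) (a : Fin d → ℝ) : Measurable fun ω => a ⬝ᵥ (W t ω - W s ω) :=
  (hW.measurable_increment_le hs hst le_rfl a).mono (ℱ.le t) le_rfl

theorem memLp_increment (hW : IsBrownianMotion P ℱ R W) {s t : ℝ} (hs : 0 ≤ s)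
    (hst : s ≤ t) (a : Fin d → ℝ) : MemLp (fun ω => a ⬝ᵥ (W t ω - W s ω)) 2 P := by
  have h := memLp_id_gaussianReal' (μ := 0)
    (v := Real.toNNReal ((t - s) * (a ⬝ᵥ (R *ᵥ a)))) 2 (by simp)
  rw [← hW.law_increments s t hs hst a] at h
  exact (memLp_map_measure_iff (by fun_prop)
    (hW.measurable_increment hs hst a).aemeasurable).1 h

theorem integral_increment (hW : IsBrownianMotion P ℱ R W) {s t : ℝ} (hs : 0 ≤ s)
    (hst : s ≤ t) (a : Fin d → ℝ) : ∫ ω, a ⬝ᵥ (W t ω - W s ω) ∂P = 0 := by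
  have h := integral_id_gaussianReal (μ := 0)
    (v := Real.toNNReal ((t - s) * (a ⬝ᵥ (R *ᵥ a))))
  rw [← hW.law_increments s t hs hst a,
    integral_map (hW.measurable_increment hs hst a).aemeasurable (by fun_prop)] at h
  exact h

theorem integral_increment_sq (hW : IsBrownianMotion P ℱ R W) (hR : R.PosDef) {s t : ℝ}
    (hs : 0 ≤ s) (hst : s ≤ t) (a : Fin d → ℝ) :
    ∫ ω, (a ⬝ᵥ (W t ω - W s ω)) ^ 2 ∂P = (t - s) * innerR R a a := by
  have h := variance_id_gaussianReal (μ := 0)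
    (v := Real.toNNReal ((t - s) * (a ⬝ᵥ (R *ᵥ a))))
  rw [variance_eq_integral (by fun_prop)] at h
  simp only [id_eq, integral_id_gaussianReal, sub_zero] at h
  rw [← hW.law_increments s t hs hst a,
    integral_map (hW.measurable_increment hs hst a).aemeasurable (by fun_prop)] at h
  rw [h]
  exact Real.coe_toNNReal _ (mul_nonneg (sub_nonneg.2 hst) (innerR_self_nonneg hR a))

theorem integral_increment_mul (hW : IsBrownianMotion P ℱ R W) (hR : R.PosDef) {s t : ℝ}
    (hs : 0 ≤ s) (hst : s ≤ t) (a b : Fin d → ℝ) :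
    ∫ ω, (a ⬝ᵥ (W t ω - W s ω)) * (b ⬝ᵥ (W t ω - W s ω)) ∂P = (t - s) * innerR R a b := by
  have ha := (hW.memLp_increment hs hst a)
  have hb := (hW.memLp_increment hs hst b)
  have h := hW.integral_increment_sq hR hs hst (a + b)
  have e : ∀ ω, ((a + b) ⬝ᵥ (W t ω - W s ω)) ^ 2 =
      (a ⬝ᵥ (W t ω - W s ω)) ^ 2 + 2 * ((a ⬝ᵥ (W t ω - W s ω)) * (b ⬝ᵥ (W t ω - W s ω))) +
        (b ⬝ᵥ (W t ω - W s ω)) ^ 2 := by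
    intro ω
    rw [add_dotProduct]
    ring
  simp_rw [e] at h
  have hab := ha.integrable_mul hb
  simp only [Pi.mul_def] at hab
  have hsum : Integrable (fun ω => (a ⬝ᵥ (W t ω - W s ω)) ^ 2 +
      2 * ((a ⬝ᵥ (W t ω - W s ω)) * (b ⬝ᵥ (W t ω - W s ω)))) P :=
    ha.integrable_sq.add (hab.const_mul 2)
  rw [integral_add hsum hb.integrable_sq, integral_add ha.integrable_sq (hab.const_mul 2), integral_const_mul,
    hW.integral_increment_sq hR hs hst, hW.integral_increment_sq hR hs hst,
    innerR_add_left, innerR_add_right, innerR_add_right, innerR_comm hR b a] at h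
  linarith

theorem indepFun_increment (hW : IsBrownianMotion P ℱ R W) {s t : ℝ} (hs : 0 ≤ s)
    (hst : s ≤ t) (a : Fin d → ℝ) {Y : Ω → ℝ} (hY : Measurable[ℱ s] Y) :
    IndepFun Y (fun ω => a ⬝ᵥ (W t ω - W s ω)) P := by
  rw [IndepFun_iff_Indep]
  refine (indep_of_indep_of_le_left (indep_of_indep_of_le_right
    (hW.indep_increments s t hs hst) hY.comap_le) ?_).symm
  exact (measurable_dotProduct_left (m := MeasurableSpace.comap (fun ω => W t ω - W s ω)
    inferInstance) (comap_measurable _) a).comap_le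

/-- Increments over intervals that do not overlap are uncorrelated. -/
theorem integral_increment_mul_of_le (hW : IsBrownianMotion P ℱ R W) {s t s' t' : ℝ}
    (hs : 0 ≤ s) (hst : s ≤ t) (hts : t ≤ s') (hst' : s' ≤ t') (a b : Fin d → ℝ) :
    ∫ ω, (a ⬝ᵥ (W t ω - W s ω)) * (b ⬝ᵥ (W t' ω - W s' ω)) ∂P = 0 := by
  have hs' : 0 ≤ s' := hs.trans (hst.trans hts)
  have h := (hW.indepFun_increment hs' hst' b
    (hW.measurable_increment_le hs hst hts a)).integral_mul_eq_mul_integral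
    (hW.measurable_increment hs hst a).aestronglyMeasurable
    (hW.measurable_increment hs' hst' b).aestronglyMeasurable
  rw [hW.integral_increment hs hst, zero_mul] at h
  exact h

/-- `𝔼[(a · W_s) (b · W_t)] = min(s, t) ⟨a, b⟩_R`. -/
theorem integral_value_mul (hW : IsBrownianMotion P ℱ R W) (hR : R.PosDef) {s t : ℝ}
    (hs : 0 ≤ s) (ht : 0 ≤ t) (a b : Fin d → ℝ) :
    ∫ ω, (a ⬝ᵥ (W s ω - W 0 ω)) * (b ⬝ᵥ (W t ω - W 0 ω)) ∂P = min s t * innerR R a b := by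
  wlog hst : s ≤ t generalizing s t a b
  · have := this ht hs b a (le_of_not_ge hst)
    rw [min_comm, innerR_comm hR, ← this]
    exact integral_congr_ae (.of_forall fun ω => mul_comm _ _)
  have e : ∀ ω, (a ⬝ᵥ (W s ω - W 0 ω)) * (b ⬝ᵥ (W t ω - W 0 ω)) =
      (a ⬝ᵥ (W s ω - W 0 ω)) * (b ⬝ᵥ (W s ω - W 0 ω)) +
        (a ⬝ᵥ (W s ω - W 0 ω)) * (b ⬝ᵥ (W t ω - W s ω)) := by
    intro ω
    rw [← mul_add, ← dotProduct_add]
    congr 2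
    abel
  simp_rw [e]
  have h1 : Integrable (fun ω => (a ⬝ᵥ (W s ω - W 0 ω)) * (b ⬝ᵥ (W s ω - W 0 ω))) P :=
    (hW.memLp_increment le_rfl hs a).integrable_mul (hW.memLp_increment le_rfl hs b)
  have h2 : Integrable (fun ω => (a ⬝ᵥ (W s ω - W 0 ω)) * (b ⬝ᵥ (W t ω - W s ω))) P :=
    (hW.memLp_increment le_rfl hs a).integrable_mul (hW.memLp_increment hs hst b)
  rw [integral_add h1 h2,
    hW.integral_increment_mul hR le_rfl hs, hW.integral_increment_mul_of_le le_rfl hs le_rfl hst,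
    min_eq_left hst]
  ring

/-- The covariance of two increments is `⟨a, b⟩_R` times the length of the overlap. -/
theorem integral_increment_mul_increment (hW : IsBrownianMotion P ℱ R W) (hR : R.PosDef)
    {s t s' t' : ℝ} (hs : 0 ≤ s) (hst : s ≤ t) (hs' : 0 ≤ s') (hst' : s' ≤ t')
    (a b : Fin d → ℝ) :
    ∫ ω, (a ⬝ᵥ (W t ω - W s ω)) * (b ⬝ᵥ (W t' ω - W s' ω)) ∂P =
      max (min t t' - max s s') 0 * innerR R a b := by
  have ht := hs.trans hst
  have ht' := hs'.trans hst'
  have e : ∀ ω, (a ⬝ᵥ (W t ω - W s ω)) * (b ⬝ᵥ (W t' ω - W s' ω)) =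
      ((a ⬝ᵥ (W t ω - W 0 ω)) * (b ⬝ᵥ (W t' ω - W 0 ω)) -
        (a ⬝ᵥ (W t ω - W 0 ω)) * (b ⬝ᵥ (W s' ω - W 0 ω))) -
      ((a ⬝ᵥ (W s ω - W 0 ω)) * (b ⬝ᵥ (W t' ω - W 0 ω)) -
        (a ⬝ᵥ (W s ω - W 0 ω)) * (b ⬝ᵥ (W s' ω - W 0 ω))) := by
    intro ω
    rw [← mul_sub, ← mul_sub, ← dotProduct_sub, ← sub_mul, ← dotProduct_sub]
    congr 2 <;> abel
  simp_rw [e]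
  have hi : ∀ u v : ℝ, 0 ≤ u → 0 ≤ v →
      Integrable (fun ω => (a ⬝ᵥ (W u ω - W 0 ω)) * (b ⬝ᵥ (W v ω - W 0 ω))) P := fun u v hu hv =>
    (hW.memLp_increment le_rfl hu a).integrable_mul (hW.memLp_increment le_rfl hv b)
  have hi2 : ∀ u : ℝ, 0 ≤ u →
      Integrable (fun ω => (a ⬝ᵥ (W u ω - W 0 ω)) * (b ⬝ᵥ (W t' ω - W 0 ω)) -
        (a ⬝ᵥ (W u ω - W 0 ω)) * (b ⬝ᵥ (W s' ω - W 0 ω))) P := fun u hu =>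
    (hi u t' hu ht').sub (hi u s' hu hs')
  rw [integral_sub (hi2 t ht) (hi2 s hs), integral_sub (hi _ _ ht ht') (hi _ _ ht hs'), integral_sub (hi _ _ hs ht') (hi _ _ hs hs'),
    hW.integral_value_mul hR ht ht', hW.integral_value_mul hR ht hs',
    hW.integral_value_mul hR hs ht', hW.integral_value_mul hR hs hs',
    ← sub_mul, ← sub_mul, ← sub_mul]
  congr 1
  grind

end IsBrownianMotion

/-! ### Step integrands -/

/-- A deterministic step integrand: the value `c i` on `(p i, p (i + 1)]` for `i < n`. -/
structure StepIntegrand (d : ℕ) where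
  n : ℕ
  p : ℕ → ℝ
  mono : Monotone p
  nonneg : 0 ≤ p 0
  c : ℕ → Fin d → ℝ

namespace StepIntegrand

/-- The step integrand as a function of time. -/
noncomputable def toFun (D : StepIntegrand d) (x : ℝ) : Fin d → ℝ :=
  ∑ i ∈ Finset.range D.n, (Ioc (D.p i) (D.p (i + 1))).indicator (fun _ => D.c i) x

/-- The stochastic integral of a step integrand with respect to `W`. -/
def integral (D : StepIntegrand d) (W : ℝ → Ω → Fin d → ℝ) (ω : Ω) : ℝ :=
  ∑ i ∈ Finset.range D.n, D.c i ⬝ᵥ (W (D.p (i + 1)) ω - W (D.p i) ω)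

theorem p_nonneg (D : StepIntegrand d) (i : ℕ) : 0 ≤ D.p i :=
  D.nonneg.trans (D.mono (Nat.zero_le i))

theorem p_le_succ (D : StepIntegrand d) (i : ℕ) : D.p i ≤ D.p (i + 1) :=
  D.mono (Nat.le_succ i)

theorem toFun_of_mem (D : StepIntegrand d) {i : ℕ} (hi : i < D.n) {x : ℝ}
    (hx : x ∈ Ioc (D.p i) (D.p (i + 1))) : D.toFun x = D.c i := by
  unfold toFun
  rw [Finset.sum_eq_single i]
  · simp [hx]
  · intro j _ hj
    refine indicator_of_notMem (fun hxj => hj ?_) _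
    rcases lt_trichotomy j i with h | h | h
    · exact absurd (hx.1.trans_le hxj.2) (D.mono h).not_gt
    · exact h
    · exact absurd (hxj.1.trans_le hx.2) (D.mono h).not_gt
  · simp [hi]

theorem exists_mem (D : StepIntegrand d) {x : ℝ} (hx : x ∈ Ioc (D.p 0) (D.p D.n)) :
    ∃ i < D.n, x ∈ Ioc (D.p i) (D.p (i + 1)) := by
  classical
  have hex : ∃ k, x ≤ D.p k := ⟨_, hx.2⟩
  have h0 : Nat.find hex ≠ 0 := fun h => by
    have := Nat.find_spec hex
    rw [h] at this
    exact this.not_gt hx.1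
  obtain ⟨i, hi⟩ := Nat.exists_eq_succ_of_ne_zero h0
  have h1 := Nat.find_spec hex
  have h2 : ¬ x ≤ D.p i := Nat.find_min hex (by omega)
  have h3 : Nat.find hex ≤ D.n := Nat.find_min' hex hx.2
  rw [hi] at h1
  exact ⟨i, by omega, not_le.1 h2, h1⟩

theorem toFun_of_notMem (D : StepIntegrand d) {x : ℝ} (hx : x ∉ Ioc (D.p 0) (D.p D.n)) :
    D.toFun x = 0 := by
  refine Finset.sum_eq_zero fun i hi => indicator_of_notMem (fun h => hx ?_) _
  exact ⟨(D.mono (Nat.zero_le i)).trans_lt h.1,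
    h.2.trans (D.mono (Finset.mem_range.1 hi))⟩

theorem abs_toFun_le (D : StepIntegrand d) {C : ℝ} (hC0 : 0 ≤ C)
    (hC : ∀ i < D.n, ∀ j, |D.c i j| ≤ C) (x : ℝ) (j : Fin d) : |D.toFun x j| ≤ C := by
  by_cases hx : x ∈ Ioc (D.p 0) (D.p D.n)
  · obtain ⟨i, hi, hxi⟩ := D.exists_mem hx
    rw [D.toFun_of_mem hi hxi]
    exact hC i hi j
  · rw [D.toFun_of_notMem hx]
    simpa

theorem measurable_toFun (D : StepIntegrand d) : Measurable D.toFun :=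
  Finset.measurable_sum _ fun _ _ => measurable_const.indicator measurableSet_Ioc

theorem measurable_integral_le (D : StepIntegrand d) (hW : IsBrownianMotion P ℱ R W) {u : ℝ}
    (hu : D.p D.n ≤ u) : Measurable[ℱ u] (D.integral W) :=
  Finset.measurable_sum _ fun i hi => hW.measurable_increment_le (D.p_nonneg i) (D.p_le_succ i)
    ((D.mono (Finset.mem_range.1 hi)).trans hu) _

theorem measurable_integral (D : StepIntegrand d) (hW : IsBrownianMotion P ℱ R W) :
    Measurable (D.integral W) :=
  (D.measurable_integral_le hW le_rfl).mono (ℱ.le _) le_rfl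

theorem memLp_integral (D : StepIntegrand d) (hW : IsBrownianMotion P ℱ R W) :
    MemLp (D.integral W) 2 P :=
  memLp_finsetSum _ fun i _ => hW.memLp_increment (D.p_nonneg i) (D.p_le_succ i) _

/-- The Itô isometry for step integrands. -/
theorem integral_mul_integral (D D' : StepIntegrand d) (hW : IsBrownianMotion P ℱ R W)
    (hR : R.PosDef) :
    ∫ ω, D.integral W ω * D'.integral W ω ∂P = ∫ x, innerR R (D.toFun x) (D'.toFun x) := by
  have hL : ∀ ω, D.integral W ω * D'.integral W ω =
      ∑ i ∈ Finset.range D.n, ∑ j ∈ Finset.range D'.n,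
        (D.c i ⬝ᵥ (W (D.p (i + 1)) ω - W (D.p i) ω)) *
          (D'.c j ⬝ᵥ (W (D'.p (j + 1)) ω - W (D'.p j) ω)) := fun ω => by
    rw [integral, integral, Finset.sum_mul_sum]
  have hE : ∀ i j x, innerR R ((Ioc (D.p i) (D.p (i + 1))).indicator (fun _ => D.c i) x)
      ((Ioc (D'.p j) (D'.p (j + 1))).indicator (fun _ => D'.c j) x) =
      (Ioc (max (D.p i) (D'.p j)) (min (D.p (i + 1)) (D'.p (j + 1)))).indicator
        (fun _ => innerR R (D.c i) (D'.c j)) x := fun i j x => by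
    rw [← Ioc_inter_Ioc]
    by_cases h : x ∈ Ioc (D.p i) (D.p (i + 1)) <;>
      by_cases h' : x ∈ Ioc (D'.p j) (D'.p (j + 1)) <;>
      simp [h, h', innerR_zero_left, innerR_zero_right, indicator]
  have hRt : ∀ x, innerR R (D.toFun x) (D'.toFun x) =
      ∑ i ∈ Finset.range D.n, ∑ j ∈ Finset.range D'.n,
        (Ioc (max (D.p i) (D'.p j)) (min (D.p (i + 1)) (D'.p (j + 1)))).indicator
        (fun _ => innerR R (D.c i) (D'.c j)) x := fun x => by
    rw [toFun, toFun, innerR_sum_left]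
    simp_rw [innerR_sum_right, hE]
  simp_rw [hL, hRt]
  have hi1 : ∀ i j, Integrable (fun ω => (D.c i ⬝ᵥ (W (D.p (i + 1)) ω - W (D.p i) ω)) *
          (D'.c j ⬝ᵥ (W (D'.p (j + 1)) ω - W (D'.p j) ω))) P := fun i j =>
    (hW.memLp_increment (D.p_nonneg i) (D.p_le_succ i) _).integrable_mul
      (hW.memLp_increment (D'.p_nonneg j) (D'.p_le_succ j) _)
  have hi2 : ∀ i j, Integrable
      ((Ioc (max (D.p i) (D'.p j)) (min (D.p (i + 1)) (D'.p (j + 1)))).indicator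
        (fun _ => innerR R (D.c i) (D'.c j))) volume := fun i j =>
    (integrable_indicator_iff measurableSet_Ioc).2 (integrableOn_const (by simp))
  rw [integral_finsetSum _ fun i _ => integrable_finsetSum _ fun j _ => hi1 i j,
    integral_finsetSum _ fun i _ => integrable_finsetSum _ fun j _ => hi2 i j]
  refine Finset.sum_congr rfl fun i _ => ?_
  rw [integral_finsetSum _ fun j _ => hi1 i j, integral_finsetSum _ fun j _ => hi2 i j]
  refine Finset.sum_congr rfl fun j _ => ?_
  rw [hW.integral_increment_mul_increment hR (D.p_nonneg i) (D.p_le_succ i) (D'.p_nonneg j)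
    (D'.p_le_succ j), integral_indicator measurableSet_Ioc, setIntegral_const, measureReal_def,
    Real.volume_Ioc, ENNReal.toReal_ofReal', smul_eq_mul]

/-- The stochastic integral of a step integrand is a centred Gaussian variable. -/
theorem exists_map_integral (D : StepIntegrand d) (hW : IsBrownianMotion P ℱ R W)
    [IsProbabilityMeasure P] :
    ∃ v, P.map (D.integral W) = gaussianReal 0 v := by
  have key : ∀ k, ∃ v, P.map (fun ω => ∑ i ∈ Finset.range k,
      D.c i ⬝ᵥ (W (D.p (i + 1)) ω - W (D.p i) ω)) = gaussianReal 0 v := by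
    intro k
    induction k with
    | zero => exact ⟨0, by simp⟩
    | succ k ih =>
      obtain ⟨v, hv⟩ := ih
      have hm : Measurable[ℱ (D.p k)] (fun ω => ∑ i ∈ Finset.range k,
          D.c i ⬝ᵥ (W (D.p (i + 1)) ω - W (D.p i) ω)) :=
        Finset.measurable_sum _ fun i hi => hW.measurable_increment_le (D.p_nonneg i)
          (D.p_le_succ i) (D.mono (Finset.mem_range.1 hi)) _
      have h := gaussianReal_add_gaussianReal_of_indepFun
        (hW.indepFun_increment (D.p_nonneg k) (D.p_le_succ k) (D.c k) hm) hv
        (hW.law_increments _ _ (D.p_nonneg k) (D.p_le_succ k) (D.c k))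
      simp_rw [Finset.sum_range_succ]
      rw [add_zero] at h
      exact ⟨_, h⟩
  exact key D.n

end StepIntegrand

end Brownian

/-! ### Wiener integrals -/

section Wiener

variable {Ω : Type*} {d : ℕ} [mΩ : MeasurableSpace Ω] {P : Measure Ω} {ℱ : Filtration ℝ mΩ}
  {R : Matrix (Fin d) (Fin d) ℝ} {W : ℝ → Ω → Fin d → ℝ}

/-- The step integrands `D n` converge to `φ` almost everywhere and boundedly, and vanish outside
a common bounded interval. -/
def Approximates (D : ℕ → StepIntegrand d) (φ : ℝ → Fin d → ℝ) : Prop :=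
  (∃ C b : ℝ, 0 ≤ C ∧ ∀ n, (D n).p (D n).n ≤ b ∧ ∀ i < (D n).n, ∀ j, |(D n).c i j| ≤ C) ∧
    ∀ᵐ x, Tendsto (fun n => (D n).toFun x) atTop (𝓝 (φ x))

/-- The pairings of two approximating sequences are dominated by a common integrable function. -/
theorem Approximates.exists_bound (R : Matrix (Fin d) (Fin d) ℝ) {D D' : ℕ → StepIntegrand d}
    {φ ψ : ℝ → Fin d → ℝ} (hD : Approximates D φ) (hD' : Approximates D' ψ) :
    ∃ B : ℝ → ℝ, Integrable B ∧ ∀ n m x, ‖innerR R ((D n).toFun x) ((D' m).toFun x)‖ ≤ B x := by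
  obtain ⟨⟨C, b, hC0, hC⟩, -⟩ := hD
  obtain ⟨⟨C', b', hC0', hC'⟩, -⟩ := hD'
  refine ⟨(Icc 0 b).indicator fun _ => (∑ i, ∑ j, |R i j|) * (C * C'), ?_, fun n m x => ?_⟩
  · exact (integrable_indicator_iff measurableSet_Icc).2 (integrableOn_const (by simp))
  · by_cases hx : x ∈ Icc 0 b
    · rw [indicator_of_mem hx]
      exact abs_innerR_le ((D n).abs_toFun_le hC0 (hC _).2 x)
        ((D' m).abs_toFun_le hC0' (hC' _).2 x)
    · rw [indicator_of_notMem hx, (D n).toFun_of_notMem, innerR_zero_left, norm_zero]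
      exact fun h => hx ⟨(D n).nonneg.trans h.1.le, h.2.trans (hC _).1⟩

theorem measurable_innerR_toFun (R : Matrix (Fin d) (Fin d) ℝ) (D D' : StepIntegrand d) :
    Measurable fun x => innerR R (D.toFun x) (D'.toFun x) :=
  (continuous_innerR (R := R)).measurable.comp (D.measurable_toFun.prodMk D'.measurable_toFun)

theorem tendsto_innerR {ι : Type*} {l : Filter ι} {f g : ι → Fin d → ℝ} {x y : Fin d → ℝ}
    (hf : Tendsto f l (𝓝 x)) (hg : Tendsto g l (𝓝 y)) :
    Tendsto (fun k => innerR R (f k) (g k)) l (𝓝 (innerR R x y)) := by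
  have h := (continuous_innerR (R := R)).tendsto (x, y)
  exact h.comp (hf.prodMk_nhds hg)

/-- Bounded convergence for the pairings of two approximating sequences. -/
theorem Approximates.tendsto_integral {D D' : ℕ → StepIntegrand d} {φ ψ : ℝ → Fin d → ℝ}
    (hD : Approximates D φ) (hD' : Approximates D' ψ) {ι : Type*} {l : Filter ι}
    [l.IsCountablyGenerated] {f g : ι → ℕ} (hf : Tendsto f l atTop) (hg : Tendsto g l atTop) :
    Tendsto (fun k => ∫ x, innerR R ((D (f k)).toFun x) ((D' (g k)).toFun x)) l
      (𝓝 (∫ x, innerR R (φ x) (ψ x))) := by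
  obtain ⟨B, hB, hle⟩ := hD.exists_bound R hD'
  refine tendsto_integral_filter_of_dominated_convergence B (.of_forall fun k => ?_)
    (.of_forall fun k => .of_forall fun x => hle _ _ x) hB ?_
  · exact (measurable_innerR_toFun R (D (f k)) (D' (g k))).aestronglyMeasurable
  · filter_upwards [hD.2, hD'.2] with x h h'
    exact tendsto_innerR (h.comp hf) (h'.comp hg)

theorem Approximates.integrable_innerR (R : Matrix (Fin d) (Fin d) ℝ)
    {D D' : ℕ → StepIntegrand d} {φ ψ : ℝ → Fin d → ℝ}
    (hD : Approximates D φ) (hD' : Approximates D' ψ) :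
    Integrable fun x => innerR R (φ x) (ψ x) := by
  obtain ⟨B, hB, hle⟩ := hD.exists_bound R hD'
  have hlim : ∀ᵐ x, Tendsto (fun n => innerR R ((D n).toFun x) ((D' n).toFun x)) atTop
      (𝓝 (innerR R (φ x) (ψ x))) := by
    filter_upwards [hD.2, hD'.2] with x h h'
    exact tendsto_innerR h h'
  refine hB.mono' (aestronglyMeasurable_of_tendsto_ae atTop
    (fun n => (measurable_innerR_toFun R (D n) (D' n)).aestronglyMeasurable) hlim) ?_
  filter_upwards [hlim] with x h
  exact le_of_tendsto h.norm (.of_forall fun n => hle n n x)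

/-- `ξ` is a Wiener integral `∫ φ · dW`: the limit in `L²` of the integrals of step integrands
that converge to `φ`. -/
def IsWienerIntegral (P : Measure Ω) (W : ℝ → Ω → Fin d → ℝ) (φ : ℝ → Fin d → ℝ)
    (ξ : Ω → ℝ) : Prop :=
  MemLp ξ 2 P ∧ ∃ D : ℕ → StepIntegrand d, Approximates D φ ∧
    Tendsto (fun n => eLpNorm ((D n).integral W - ξ) 2 P) atTop (𝓝 0)

theorem IsWienerIntegral.congr_ae {φ : ℝ → Fin d → ℝ} {ξ η : Ω → ℝ}
    (h : IsWienerIntegral P W φ ξ) (hη : ξ =ᵐ[P] η) : IsWienerIntegral P W φ η := by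
  obtain ⟨hξ, D, hD, hlim⟩ := h
  refine ⟨hξ.ae_eq hη, D, hD, hlim.congr fun n => eLpNorm_congr_ae ?_⟩
  filter_upwards [hη] with ω h
  simp [h]

/-- The integrals of an approximating sequence of step integrands converge in `L²`. -/
theorem Approximates.exists_isWienerIntegral (hW : IsBrownianMotion P ℱ R W) (hR : R.PosDef)
    {D : ℕ → StepIntegrand d} {φ : ℝ → Fin d → ℝ} (hD : Approximates D φ) :
    ∃ ξ, IsWienerIntegral P W φ ξ ∧
      Tendsto (fun n => eLpNorm ((D n).integral W - ξ) 2 P) atTop (𝓝 0) := by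
  set S : ℕ → Lp ℝ 2 P := fun n => ((D n).memLp_integral hW).toLp _ with hS
  have hinner : ∀ n m, inner ℝ (S n) (S m) = ∫ x, innerR R ((D n).toFun x) ((D m).toFun x) := by
    intro n m
    rw [← (D n).integral_mul_integral (D m) hW hR, L2.inner_def]
    refine integral_congr_ae ?_
    filter_upwards [((D n).memLp_integral hW).coeFn_toLp, ((D m).memLp_integral hW).coeFn_toLp]
      with ω h h'
    simp only [hS, h, h', RCLike.inner_apply, conj_trivial]
    ring
  have hcauchy : CauchySeq S := by
    rw [cauchySeq_iff_tendsto_dist_atTop_0]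
    have h1 := fun (f g : ℕ × ℕ → ℕ) (hf : Tendsto f atTop atTop) (hg : Tendsto g atTop atTop) =>
      hD.tendsto_integral (R := R) hD hf hg
    have hfst : Tendsto (Prod.fst : ℕ × ℕ → ℕ) atTop atTop := by
      rw [← prod_atTop_atTop_eq]; exact tendsto_fst
    have hsnd : Tendsto (Prod.snd : ℕ × ℕ → ℕ) atTop atTop := by
      rw [← prod_atTop_atTop_eq]; exact tendsto_snd
    have h2 := ((h1 _ _ hfst hfst).sub ((h1 _ _ hfst hsnd).const_mul 2)).add (h1 _ _ hsnd hsnd)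
    have h3 := h2.sqrt
    rw [show ∀ y : ℝ, y - 2 * y + y = 0 by intro y; ring, Real.sqrt_zero] at h3
    refine h3.congr fun k => ?_
    rw [← hinner, ← hinner, ← hinner, dist_eq_norm, eq_comm,
      ← Real.sqrt_sq (norm_nonneg (S k.1 - S k.2)), norm_sub_sq_real,
      real_inner_self_eq_norm_sq, real_inner_self_eq_norm_sq]
  obtain ⟨g, hg⟩ := cauchySeq_tendsto_of_complete hcauchy
  have hlim : Tendsto (fun n => eLpNorm ((D n).integral W - (g : Ω → ℝ)) 2 P) atTop
      (𝓝 0) := by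
    rw [← Lp.tendsto_Lp_iff_tendsto_eLpNorm'' _ (fun n => (D n).memLp_integral hW) _ (Lp.memLp g)]
    simpa using hg
  exact ⟨g, ⟨Lp.memLp g, D, hD, hlim⟩, hlim⟩

/-- A limit in probability, as in the definition of the Itô integral, is automatically a limit in
`L²`. -/
theorem Approximates.isWienerIntegral_of_tendstoInMeasure (hW : IsBrownianMotion P ℱ R W)
    (hR : R.PosDef) {D : ℕ → StepIntegrand d} {φ : ℝ → Fin d → ℝ} (hD : Approximates D φ)
    {ξ : Ω → ℝ} (hξ : TendstoInMeasure P (fun n => (D n).integral W) atTop ξ) :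
    IsWienerIntegral P W φ ξ := by
  obtain ⟨η, hη, hlim⟩ := hD.exists_isWienerIntegral hW hR
  refine hη.congr_ae ?_
  exact tendstoInMeasure_ae_unique (tendstoInMeasure_of_tendsto_eLpNorm two_ne_zero
    (fun n => ((D n).memLp_integral hW).1) hη.1.1 hlim) hξ

/-- The Itô isometry. -/
theorem IsWienerIntegral.integral_mul (hW : IsBrownianMotion P ℱ R W) (hR : R.PosDef)
    {φ ψ : ℝ → Fin d → ℝ} {ξ η : Ω → ℝ} (hξ : IsWienerIntegral P W φ ξ)
    (hη : IsWienerIntegral P W ψ η) :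
    ∫ ω, ξ ω * η ω ∂P = ∫ x, innerR R (φ x) (ψ x) := by
  obtain ⟨hξ2, D, hD, hDlim⟩ := hξ
  obtain ⟨hη2, D', hD', hDlim'⟩ := hη
  have h1 := (Lp.tendsto_Lp_iff_tendsto_eLpNorm'' _ (fun n => (D n).memLp_integral hW) _ hξ2).2
    hDlim
  have h2 := (Lp.tendsto_Lp_iff_tendsto_eLpNorm'' _ (fun n => (D' n).memLp_integral hW) _ hη2).2
    hDlim'
  have hin : ∀ {f g : Ω → ℝ} (hf : MemLp f 2 P) (hg : MemLp g 2 P),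
      inner ℝ (hf.toLp f) (hg.toLp g) = ∫ ω, f ω * g ω ∂P := by
    intro f g hf hg
    rw [L2.inner_def]
    refine integral_congr_ae ?_
    filter_upwards [hf.coeFn_toLp, hg.coeFn_toLp] with ω h h'
    simp only [h, h', RCLike.inner_apply, conj_trivial]
    ring
  have h3 := h1.inner (𝕜 := ℝ) h2
  simp_rw [hin, StepIntegrand.integral_mul_integral _ _ hW hR] at h3
  exact tendsto_nhds_unique h3 (hD.tendsto_integral hD' tendsto_id tendsto_id)

theorem IsWienerIntegral.integral_sq_sub (hW : IsBrownianMotion P ℱ R W) (hR : R.PosDef)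
    {φ ψ : ℝ → Fin d → ℝ} {ξ η : Ω → ℝ} (hξ : IsWienerIntegral P W φ ξ)
    (hη : IsWienerIntegral P W ψ η) :
    ∫ ω, (ξ ω - η ω) ^ 2 ∂P = ∫ x, innerR R (φ x - ψ x) (φ x - ψ x) := by
  have hξξ := hξ.integral_mul hW hR hξ
  have hξη := hξ.integral_mul hW hR hη
  have hηη := hη.integral_mul hW hR hη
  obtain ⟨hξ2, D, hD, -⟩ := hξ
  obtain ⟨hη2, D', hD', -⟩ := hη
  have e1 : ∀ ω, (ξ ω - η ω) ^ 2 = ξ ω * ξ ω - 2 * (ξ ω * η ω) + η ω * η ω := fun ω => by ring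
  have e2 : ∀ x, innerR R (φ x - ψ x) (φ x - ψ x) =
      innerR R (φ x) (φ x) - 2 * innerR R (φ x) (ψ x) + innerR R (ψ x) (ψ x) := fun x => by
    simp only [innerR_sub_left, innerR_sub_right, innerR_comm hR (ψ x) (φ x)]
    ring
  simp_rw [e1, e2]
  have i1 : Integrable (fun ω => ξ ω * ξ ω) P := hξ2.integrable_mul hξ2
  have i2 : Integrable (fun ω => 2 * (ξ ω * η ω)) P := (hξ2.integrable_mul hη2).const_mul 2
  have i3 : Integrable (fun ω => η ω * η ω) P := hη2.integrable_mul hη2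
  have i12 : Integrable (fun ω => ξ ω * ξ ω - 2 * (ξ ω * η ω)) P := i1.sub i2
  have j1 := hD.integrable_innerR R hD
  have j2 := (hD.integrable_innerR R hD').const_mul 2
  have j3 := hD'.integrable_innerR R hD'
  have j12 : Integrable (fun x => innerR R (φ x) (φ x) - 2 * innerR R (φ x) (ψ x)) := j1.sub j2
  rw [integral_add i12 i3, integral_sub i1 i2, integral_add j12 j3, integral_sub j1 j2,
    integral_const_mul, integral_const_mul, hξξ, hξη, hηη]

/-- A Wiener integral is a centred Gaussian variable. -/
theorem IsWienerIntegral.map_eq [IsProbabilityMeasure P] (hW : IsBrownianMotion P ℱ R W)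
    (hR : R.PosDef) {φ : ℝ → Fin d → ℝ} {ξ : Ω → ℝ} (hξ : IsWienerIntegral P W φ ξ) :
    P.map ξ = gaussianReal 0 (Real.toNNReal (∫ x, innerR R (φ x) (φ x))) := by
  obtain ⟨hξ2, D, hD, hlim⟩ := hξ
  choose v hv using fun n => (D n).exists_map_integral hW
  have hvar : ∀ n, (v n : ℝ) = ∫ x, innerR R ((D n).toFun x) ((D n).toFun x) := by
    intro n
    have h := variance_id_gaussianReal (μ := 0) (v := v n)
    rw [variance_eq_integral (by fun_prop)] at h
    simp only [id_eq, integral_id_gaussianReal, sub_zero] at h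
    rw [← hv n, integral_map ((D n).measurable_integral hW).aemeasurable (by fun_prop)] at h
    rw [← h, ← (D n).integral_mul_integral (D n) hW hR]
    simp_rw [sq]
  have hvlim : Tendsto (fun n => (v n : ℝ)) atTop (𝓝 (∫ x, innerR R (φ x) (φ x))) := by
    simp_rw [hvar]
    exact hD.tendsto_integral hD tendsto_id tendsto_id
  obtain ⟨ns, hns, hae⟩ := (tendstoInMeasure_of_tendsto_eLpNorm two_ne_zero
    (fun n => ((D n).memLp_integral hW).1) hξ2.1 hlim).exists_seq_tendsto_ae
  have := Measure.isProbabilityMeasure_map (μ := P) hξ2.1.aemeasurable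
  refine Measure.ext_of_charFun (funext fun θ => ?_)
  have h1 : Tendsto (fun k => charFun (P.map ((D (ns k)).integral W)) θ) atTop
      (𝓝 (charFun (P.map ξ) θ)) := by
    have e : ∀ f : Ω → ℝ, AEMeasurable f P →
        charFun (P.map f) θ = ∫ ω, Complex.exp (θ * f ω * Complex.I) ∂P := by
      intro f hf
      rw [charFun_apply_real, integral_map hf (by fun_prop)]
    rw [e _ hξ2.1.aemeasurable]
    simp_rw [e _ ((D (ns _)).measurable_integral hW).aemeasurable]
    refine tendsto_integral_of_dominated_convergence (fun _ => 1) (fun k => ?_)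
      (integrable_const 1) (fun k => .of_forall fun ω => ?_) ?_
    · have := (D (ns k)).measurable_integral hW
      fun_prop
    · rw [← Complex.ofReal_mul, Complex.norm_exp_ofReal_mul_I]
    · filter_upwards [hae] with ω hω
      have hc : Continuous fun y : ℝ => Complex.exp (θ * y * Complex.I) := by fun_prop
      exact (hc.tendsto (ξ ω)).comp hω
  refine tendsto_nhds_unique h1 ?_
  simp_rw [hv, charFun_gaussianReal]
  have hpos : 0 ≤ ∫ x, innerR R (φ x) (φ x) := integral_nonneg fun x => innerR_self_nonneg hR _
  rw [Real.coe_toNNReal _ hpos]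
  have hc : Continuous fun y : ℝ =>
    Complex.exp ((θ : ℂ) * ((0 : ℝ) : ℂ) * Complex.I - (y : ℂ) * (θ : ℂ) ^ 2 / 2) := by fun_prop
  exact (hc.tendsto _).comp (hvlim.comp hns.tendsto_atTop)

end Wiener

/-! ### Riemann sums -/

section Riemann

variable {Ω : Type*} {d : ℕ} [mΩ : MeasurableSpace Ω] {P : Measure Ω} {ℱ : Filtration ℝ mΩ}
  {R : Matrix (Fin d) (Fin d) ℝ} {W : ℝ → Ω → Fin d → ℝ}

theorem StepIntegrand.approximates_const (D : StepIntegrand d) :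
    Approximates (fun _ => D) D.toFun := by
  refine ⟨⟨∑ i ∈ Finset.range D.n, ∑ j, |D.c i j|, D.p D.n, by positivity, fun _ => ⟨le_rfl, ?_⟩⟩,
    .of_forall fun x => tendsto_const_nhds⟩
  intro i hi j
  calc |D.c i j| ≤ ∑ j, |D.c i j| :=
        Finset.single_le_sum (f := fun j => |D.c i j|) (fun _ _ => abs_nonneg _)
          (Finset.mem_univ j)
    _ ≤ _ := Finset.single_le_sum (f := fun i => ∑ j, |D.c i j|)
        (fun _ _ => Finset.sum_nonneg fun _ _ => abs_nonneg _) (Finset.mem_range.2 hi)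

theorem StepIntegrand.isWienerIntegral (D : StepIntegrand d) (hW : IsBrownianMotion P ℱ R W) :
    IsWienerIntegral P W D.toFun (D.integral W) :=
  ⟨D.memLp_integral hW, fun _ => D, D.approximates_const, by simp⟩

theorem Approximates.integrable_innerR_sub (hR : R.PosDef)
    {D D' : ℕ → StepIntegrand d} {φ ψ : ℝ → Fin d → ℝ}
    (hD : Approximates D φ) (hD' : Approximates D' ψ) :
    Integrable fun x => innerR R (φ x - ψ x) (φ x - ψ x) := by
  have e2 : ∀ x, innerR R (φ x - ψ x) (φ x - ψ x) =
      innerR R (φ x) (φ x) - 2 * innerR R (φ x) (ψ x) + innerR R (ψ x) (ψ x) := fun x => by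
    simp only [innerR_sub_left, innerR_sub_right, innerR_comm hR (ψ x) (φ x)]
    ring
  simp_rw [e2]
  exact ((hD.integrable_innerR R hD).sub ((hD.integrable_innerR R hD').const_mul 2)).add
    (hD'.integrable_innerR R hD')

/-- A deterministic integrand on `[a, b]` that is bounded and, at almost every time,
left-continuous. (A spliced control fails to be left-continuous at the time of the switch.) -/
structure IsRegular (a b : ℝ) (H : ℝ → Fin d → ℝ) : Prop where
  bounded : ∃ C, 0 ≤ C ∧ ∀ s ∈ Icc a b, ∀ i, |H s i| ≤ C
  leftCont : ∀ᵐ s, s ∈ Ioc a b → Tendsto H (𝓝[<] s) (𝓝 (H s))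

theorem IsRegular.mono {a b a' b' : ℝ} {H : ℝ → Fin d → ℝ} (h : IsRegular a b H) (ha : a ≤ a')
    (hb : b' ≤ b) : IsRegular a' b' H := by
  obtain ⟨C, hC0, hC⟩ := h.bounded
  refine ⟨⟨C, hC0, fun s hs => hC s ⟨ha.trans hs.1, hs.2.trans hb⟩⟩, ?_⟩
  filter_upwards [h.leftCont] with s h hs
  exact h ⟨ha.trans_lt hs.1, hs.2.trans hb⟩

/-- The integrand `H` on `[a, b]` sampled at the left endpoints of the equidistant partition into
`n` intervals, where only the intervals contained in `(-∞, s]` are kept. Its integral is known at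
time `s`. -/
noncomputable def riemannStep (a b : ℝ) (ha : 0 ≤ a) (hab : a ≤ b) (H : ℝ → Fin d → ℝ) (s : ℝ)
    (n : ℕ) : StepIntegrand d where
  n := n
  p i := a + i * ((b - a) / n)
  mono := fun i j hij => by
    have : 0 ≤ (b - a) / n := div_nonneg (sub_nonneg.2 hab) (Nat.cast_nonneg n)
    have h : (i : ℝ) ≤ j := Nat.cast_le.2 hij
    simp only
    gcongr
  nonneg := by simpa
  c i := if a + (i + 1) * ((b - a) / n) ≤ s then H (a + i * ((b - a) / n)) else 0

variable {a b : ℝ} {ha : 0 ≤ a} {hab : a ≤ b} {H : ℝ → Fin d → ℝ}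

theorem riemannStep_last {s : ℝ} {n : ℕ} (hn : n ≠ 0) :
    (riemannStep a b ha hab H s n).p n = b := by
  have : (n : ℝ) ≠ 0 := Nat.cast_ne_zero.2 hn
  simp only [riemannStep]
  field_simp
  ring

theorem riemannStep_last_le {s : ℝ} {n : ℕ} : (riemannStep a b ha hab H s n).p n ≤ b := by
  rcases eq_or_ne n 0 with rfl | hn
  · simpa [riemannStep]
  · exact (riemannStep_last hn).le

theorem riemannStep_c_of_le {s : ℝ} {n i : ℕ}
    (h : (riemannStep a b ha hab H s n).p (i + 1) ≤ s) :
    (riemannStep a b ha hab H s n).c i = H ((riemannStep a b ha hab H s n).p i) := by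
  simp only [riemannStep, Nat.cast_add, Nat.cast_one] at h ⊢
  rw [if_pos h]

theorem riemannStep_c_of_lt {s : ℝ} {n i : ℕ}
    (h : s < (riemannStep a b ha hab H s n).p (i + 1)) :
    (riemannStep a b ha hab H s n).c i = 0 := by
  simp only [riemannStep, Nat.cast_add, Nat.cast_one] at h ⊢
  rw [if_neg h.not_ge]

theorem riemannStep_p_succ {s : ℝ} {n i : ℕ} :
    (riemannStep a b ha hab H s n).p (i + 1) =
      (riemannStep a b ha hab H s n).p i + (b - a) / n := by
  simp only [riemannStep]
  push_cast
  ring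

theorem riemannStep_p_mem {s : ℝ} {n i : ℕ} (hi : i < n) :
    (riemannStep a b ha hab H s n).p i ∈ Icc a b := by
  refine ⟨?_, ((riemannStep a b ha hab H s n).mono hi.le).trans riemannStep_last_le⟩
  have := (riemannStep a b ha hab H s n).mono (Nat.zero_le i)
  simpa [riemannStep] using this

theorem riemannStep_abs_c_le {s C : ℝ} (hC0 : 0 ≤ C) (hC : ∀ s ∈ Icc a b, ∀ i, |H s i| ≤ C)
    {n i : ℕ} (hi : i < n) (j : Fin d) : |(riemannStep a b ha hab H s n).c i j| ≤ C := by
  rcases le_or_gt ((riemannStep a b ha hab H s n).p (i + 1)) s with h | h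
  · rw [riemannStep_c_of_le h]
    exact hC _ (riemannStep_p_mem hi) j
  · rw [riemannStep_c_of_lt h]
    simpa

theorem riemannStep_toFun_of_notMem {s x : ℝ} {n : ℕ} (hx : x ∉ Ioc a b) :
    (riemannStep a b ha hab H s n).toFun x = 0 := by
  refine StepIntegrand.toFun_of_notMem _ fun h => hx ⟨?_, h.2.trans riemannStep_last_le⟩
  simpa [riemannStep] using h.1

/-- The interval of the partition that contains `x`; it does not depend on the truncation. -/
theorem riemannStep_exists {x : ℝ} (hx : x ∈ Ioc a b) {n : ℕ} (hn : n ≠ 0) :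
    ∃ i < n, ∀ s, x ∈ Ioc ((riemannStep a b ha hab H s n).p i)
      ((riemannStep a b ha hab H s n).p (i + 1)) := by
  obtain ⟨i, hi, h⟩ := (riemannStep a b ha hab H b n).exists_mem (x := x)
    (by
      rw [show (riemannStep a b ha hab H b n).n = n from rfl, riemannStep_last hn]
      simpa [riemannStep] using hx)
  exact ⟨i, hi, fun s => h⟩

/-- The integral of the untruncated sampled integrand is the Riemann sum in the definition of the
Itô integral. -/
theorem riemannStep_integral {Ω : Type*} {W : ℝ → Ω → Fin d → ℝ} (n : ℕ) (ω : Ω) :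
    (riemannStep a b ha hab H b n).integral W ω = ∑ i ∈ Finset.range n,
      H (a + i * ((b - a) / n)) ⬝ᵥ
        (W (a + (i + 1) * ((b - a) / n)) ω - W (a + i * ((b - a) / n)) ω) := by
  refine Finset.sum_congr rfl fun i hi => ?_
  have h : (riemannStep a b ha hab H b n).p (i + 1) ≤ b :=
    ((riemannStep a b ha hab H b n).mono (Finset.mem_range.1 hi)).trans riemannStep_last_le
  rw [riemannStep_c_of_le h]
  simp [riemannStep]

theorem tendsto_mesh (a b : ℝ) : Tendsto (fun n : ℕ => (b - a) / n) atTop (𝓝 0) :=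
  tendsto_const_div_atTop_nhds_zero_nat _

theorem approximates_riemannStep (hH : IsRegular a b H) {s : ℝ} (hs : s ≤ b) :
    Approximates (riemannStep a b ha hab H s) ((Ioc a s).indicator H) := by
  obtain ⟨C, hC0, hC⟩ := hH.bounded
  refine ⟨⟨C, b, hC0, fun n => ⟨riemannStep_last_le, fun i hi j =>
    riemannStep_abs_c_le hC0 hC hi j⟩⟩, ?_⟩
  have hne : ∀ᵐ x : ℝ, x ≠ s := by simp [ae_iff]
  filter_upwards [hH.leftCont, hne] with x hx hxs
  by_cases hxab : x ∈ Ioc a b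
  swap
  · rw [indicator_of_notMem fun h => hxab ⟨h.1, h.2.trans hs⟩]
    simp_rw [riemannStep_toFun_of_notMem hxab]
    exact tendsto_const_nhds
  rcases lt_or_gt_of_ne hxs with hlt | hgt
  · rw [indicator_of_mem (show x ∈ Ioc a s from ⟨hxab.1, hlt.le⟩)]
    refine Metric.tendsto_nhds.2 fun ε hε => ?_
    obtain ⟨δ, hδ, hδ'⟩ := Metric.mem_nhdsWithin_iff.1
      (Metric.tendsto_nhds.1 (hx hxab) ε hε)
    filter_upwards [eventually_ne_atTop 0,
      (tendsto_mesh a b).eventually (gt_mem_nhds (lt_min hδ (sub_pos.2 hlt)))] with n hn hmesh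
    obtain ⟨i, hi, hxi⟩ := riemannStep_exists (ha := ha) (hab := hab) (H := H) hxab hn
    have hxi := hxi s
    have hsucc := riemannStep_p_succ (ha := ha) (hab := hab) (H := H) (s := s) (n := n) (i := i)
    rw [lt_min_iff] at hmesh
    rw [(riemannStep a b ha hab H s n).toFun_of_mem hi hxi,
      riemannStep_c_of_le (by linarith [hxi.1])]
    refine hδ' ⟨?_, hxi.1⟩
    rw [Metric.mem_ball, Real.dist_eq, abs_lt]
    constructor <;> linarith [hxi.1, hxi.2]
  · rw [indicator_of_notMem fun h => hgt.not_ge h.2]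
    refine tendsto_const_nhds.congr' ?_
    filter_upwards [eventually_ne_atTop 0] with n hn
    obtain ⟨i, hi, hxi⟩ := riemannStep_exists (ha := ha) (hab := hab) (H := H) hxab hn
    rw [(riemannStep a b ha hab H s n).toFun_of_mem hi (hxi s),
      riemannStep_c_of_lt (hgt.trans_le (hxi s).2)]

theorem IsRegular.aestronglyMeasurable (ha : 0 ≤ a) (hab : a ≤ b) (hH : IsRegular a b H) :
    AEStronglyMeasurable ((Ioc a b).indicator H) volume :=
  aestronglyMeasurable_of_tendsto_ae atTop
    (fun n => (riemannStep a b ha hab H b n).measurable_toFun.aestronglyMeasurable)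
    (approximates_riemannStep hH le_rfl).2

/-- Truncating at `s` costs at most the contribution of one interval of the partition. -/
theorem innerR_riemannStep_sub_le (hR : R.PosDef) {C : ℝ} (hC0 : 0 ≤ C)
    (hC : ∀ s ∈ Icc a b, ∀ i, |H s i| ≤ C) {s : ℝ} (hs : s ≤ b) {n : ℕ} (hn : n ≠ 0) (x : ℝ) :
    innerR R ((riemannStep a b ha hab H s n).toFun x - (Ioc a s).indicator H x)
        ((riemannStep a b ha hab H s n).toFun x - (Ioc a s).indicator H x) ≤
      innerR R ((riemannStep a b ha hab H b n).toFun x - (Ioc a b).indicator H x)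
        ((riemannStep a b ha hab H b n).toFun x - (Ioc a b).indicator H x) +
      (Ioc (s - (b - a) / n) s).indicator
        (fun _ => (∑ i, ∑ j, |R i j|) * ((C + C) * (C + C))) x := by
  have hK : 0 ≤ (∑ i, ∑ j, |R i j|) * ((C + C) * (C + C)) := by positivity
  have hI : 0 ≤ (Ioc (s - (b - a) / n) s).indicator
        (fun _ => (∑ i, ∑ j, |R i j|) * ((C + C) * (C + C))) x :=
    indicator_nonneg (fun _ _ => hK) x
  by_cases hxab : x ∈ Ioc a b
  swap
  · rw [riemannStep_toFun_of_notMem hxab, riemannStep_toFun_of_notMem hxab,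
      indicator_of_notMem hxab, indicator_of_notMem fun h => hxab ⟨h.1, h.2.trans hs⟩]
    simpa [innerR_zero_left]
  obtain ⟨i, hi, hxi⟩ := riemannStep_exists (ha := ha) (hab := hab) (H := H) hxab hn
  rcases lt_or_ge s x with hsx | hxs
  · rw [(riemannStep a b ha hab H s n).toFun_of_mem hi (hxi s),
      riemannStep_c_of_lt (hsx.trans_le (hxi s).2), indicator_of_notMem fun h => hsx.not_ge h.2,
      sub_zero, innerR_zero_left]
    exact add_nonneg (innerR_self_nonneg hR _) hI
  rcases le_or_gt x (s - (b - a) / n) with hlt | hge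
  · have h1 := riemannStep_p_succ (ha := ha) (hab := hab) (H := H) (s := s) (n := n) (i := i)
    have h2 : (riemannStep a b ha hab H b n).p (i + 1) ≤ b :=
      ((riemannStep a b ha hab H b n).mono hi).trans riemannStep_last_le
    rw [(riemannStep a b ha hab H s n).toFun_of_mem hi (hxi s),
      (riemannStep a b ha hab H b n).toFun_of_mem hi (hxi b),
      riemannStep_c_of_le (by linarith [(hxi s).1]), riemannStep_c_of_le h2,
      indicator_of_mem (show x ∈ Ioc a s from ⟨hxab.1, hxs⟩), indicator_of_mem hxab]
    exact le_add_of_nonneg_right hI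
  · rw [indicator_of_mem (show x ∈ Ioc (s - (b - a) / n) s from ⟨hge, hxs⟩)]
    refine le_add_of_nonneg_of_le (innerR_self_nonneg hR _) ?_
    have hb : ∀ j, |((riemannStep a b ha hab H s n).toFun x - (Ioc a s).indicator H x) j| ≤
        C + C := fun j => by
      rw [indicator_of_mem (show x ∈ Ioc a s from ⟨hxab.1, hxs⟩), Pi.sub_apply]
      refine (abs_sub _ _).trans (add_le_add ?_ (hC x ⟨hxab.1.le, hxab.2⟩ j))
      exact StepIntegrand.abs_toFun_le _ hC0
        (fun i hi j => riemannStep_abs_c_le hC0 hC hi j) x j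
    exact (le_abs_self _).trans (abs_innerR_le hb hb)

/-- The truncated Riemann sums converge to the Wiener integrals over `(a, s]` in `L²`, uniformly
in `s`. -/
theorem exists_riemannStep_uniform (hW : IsBrownianMotion P ℱ R W) (hR : R.PosDef) (ha : 0 ≤ a)
    (hab : a ≤ b) (hH : IsRegular a b H) :
    ∃ ε : ℕ → ℝ, Tendsto ε atTop (𝓝 0) ∧ ∀ n ≠ 0, ∀ s ≤ b, ∀ ξ,
      IsWienerIntegral P W ((Ioc a s).indicator H) ξ →
        ∫ ω, ((riemannStep a b ha hab H s n).integral W ω - ξ ω) ^ 2 ∂P ≤ ε n := by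
  obtain ⟨C, hC0, hC⟩ := hH.bounded
  set K := (∑ i, ∑ j, |R i j|) * ((C + C) * (C + C)) with hKdef
  have hint : ∀ s ≤ b, ∀ n, Integrable fun x =>
      innerR R ((riemannStep a b ha hab H s n).toFun x - (Ioc a s).indicator H x)
        ((riemannStep a b ha hab H s n).toFun x - (Ioc a s).indicator H x) := fun s hs n =>
    (StepIntegrand.approximates_const _).integrable_innerR_sub hR
      (approximates_riemannStep (ha := ha) (hab := hab) hH hs)
  refine ⟨fun n => (∫ x, innerR R
    ((riemannStep a b ha hab H b n).toFun x - (Ioc a b).indicator H x)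
        ((riemannStep a b ha hab H b n).toFun x - (Ioc a b).indicator H x)) + (b - a) / n * K,
    ?_, fun n hn s hs ξ hξ => ?_⟩
  · have h1 : Tendsto (fun n => ∫ x, innerR R
        ((riemannStep a b ha hab H b n).toFun x - (Ioc a b).indicator H x)
        ((riemannStep a b ha hab H b n).toFun x - (Ioc a b).indicator H x)) atTop
        (𝓝 (∫ x : ℝ, (0 : ℝ))) := by
      refine tendsto_integral_of_dominated_convergence ((Ioc a b).indicator fun _ => K)
        (fun n => (hint b le_rfl n).aestronglyMeasurable)
        ((integrable_indicator_iff measurableSet_Ioc).2 (integrableOn_const (by simp)))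
        (fun n => .of_forall fun x => ?_) ?_
      · by_cases hx : x ∈ Ioc a b
        · have hb : ∀ j, |((riemannStep a b ha hab H b n).toFun x -
              (Ioc a b).indicator H x) j| ≤ C + C := fun j => by
            rw [indicator_of_mem hx, Pi.sub_apply]
            refine (abs_sub _ _).trans (add_le_add ?_ (hC x ⟨hx.1.le, hx.2⟩ j))
            exact StepIntegrand.abs_toFun_le _ hC0
              (fun i hi j => riemannStep_abs_c_le hC0 hC hi j) x j
          rw [indicator_of_mem (a := x) hx fun _ => K]
          exact abs_innerR_le hb hb
        · rw [riemannStep_toFun_of_notMem hx, indicator_of_notMem hx, indicator_of_notMem hx]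
          simp [innerR_zero_left]
      · filter_upwards [(approximates_riemannStep (ha := ha) (hab := hab) hH le_rfl).2] with x hx
        have h := hx.sub_const ((Ioc a b).indicator H x)
        rw [sub_self] at h
        simpa [innerR_zero_left] using tendsto_innerR (R := R) h h
    simpa using h1.add ((tendsto_mesh a b).mul_const K)
  · have hmesh : 0 ≤ (b - a) / n := div_nonneg (sub_nonneg.2 hab) (Nat.cast_nonneg n)
    have hconst : Integrable ((Ioc (s - (b - a) / n) s).indicator fun _ => K) :=
      (integrable_indicator_iff measurableSet_Ioc).2 (integrableOn_const (by simp))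
    rw [((riemannStep a b ha hab H s n).isWienerIntegral hW).integral_sq_sub hW hR hξ]
    refine (integral_mono (hint s hs n) ((hint b le_rfl n).add hconst) fun x =>
      innerR_riemannStep_sub_le hR hC0 hC hs hn x).trans_eq ?_
    rw [integral_add' (hint b le_rfl n) hconst, integral_indicator measurableSet_Ioc,
      setIntegral_const, measureReal_def, Real.volume_Ioc, sub_sub_cancel,
      ENNReal.toReal_ofReal hmesh, smul_eq_mul]

end Riemann

/-! ### Stochastic Fubini theorem -/

section Fubini

/-- Integration by parts against the primitive of an integrable function. -/
theorem integral_deriv_mul_primitive {a b : ℝ} {f f' y : ℝ → ℝ}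
    (hf : ∀ x, HasDerivAt f (f' x) x) (hf' : Continuous f')
    (hy : IntervalIntegrable y volume a b) :
    ∫ q in a..b, f' q * ∫ p in a..q, y p = ∫ p in a..b, (f b - f p) * y p := by
  have hd : deriv f = f' := funext fun x => (hf x).deriv
  have hf1 : ContDiff ℝ 1 f := by
    rw [contDiff_one_iff_deriv, hd]
    exact ⟨fun x => (hf x).differentiableAt, hf'⟩
  have h1 : AbsolutelyContinuousOnInterval f a b :=
    hf1.contDiffOn.absolutelyContinuousOnInterval
  have h2 := hy.absolutelyContinuousOnInterval_intervalIntegral (c := a) (by simp)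
  have h3 := h1.integral_mul_deriv_eq_deriv_mul h2
  rw [hd] at h3
  have h4 : ∫ x in a..b, f x * deriv (fun x => ∫ v in a..x, y v) x = ∫ x in a..b, f x * y x := by
    refine intervalIntegral.integral_congr_ae ?_
    filter_upwards [hy.ae_hasDerivAt_integral] with x hx hxm
    rw [(hx (uIoc_subset_uIcc hxm) a (by simp)).deriv]
  rw [h4, intervalIntegral.integral_same, mul_zero, sub_zero] at h3
  have hfc : ContinuousOn f (uIcc a b) := hf1.continuous.continuousOn
  simp_rw [sub_mul]
  rw [intervalIntegral.integral_sub (hy.const_mul _) (hy.continuousOn_mul hfc),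
    intervalIntegral.integral_const_mul, h3]
  ring

variable {Ω : Type*} {d : ℕ} {R : Matrix (Fin d) (Fin d) ℝ} {a b : ℝ} {H : ℝ → Fin d → ℝ}

theorem IsRegular.intervalIntegrable_apply (ha : 0 ≤ a) (hab : a ≤ b) (hH : IsRegular a b H)
    (i : Fin d) : IntervalIntegrable (fun s => H s i) volume a b := by
  obtain ⟨C, hC0, hC⟩ := hH.bounded
  rw [intervalIntegrable_iff_integrableOn_Ioc_of_le hab]
  have hm : AEStronglyMeasurable H (volume.restrict (Ioc a b)) :=
    (aestronglyMeasurable_indicator_iff measurableSet_Ioc).1 (hH.aestronglyMeasurable ha hab)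
  refine Integrable.of_bound ((continuous_apply i).comp_aestronglyMeasurable hm) C ?_
  filter_upwards [ae_restrict_mem measurableSet_Ioc] with x hx
  exact hC x ⟨hx.1.le, hx.2⟩ i

theorem tendsto_of_continuousOn_Icc {E : Type*} [TopologicalSpace E] {f : ℝ → E}
    (hf : ContinuousOn f (Icc a b)) {s : ℝ} (hs : s ∈ Ioc a b) :
    Tendsto f (𝓝[<] s) (𝓝 (f s)) := by
  refine (hf s ⟨hs.1.le, hs.2⟩).tendsto.mono_left ?_
  rw [← nhdsWithin_Ioo_eq_nhdsLT hs.1]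
  exact nhdsWithin_mono _ fun y hy => ⟨hy.1.le, hy.2.le.trans hs.2⟩

theorem IsRegular.smul (hH : IsRegular a b H) {f : ℝ → ℝ} (hf : ContinuousOn f (Icc a b)) :
    IsRegular a b fun s => f s • H s := by
  obtain ⟨C, hC0, hC⟩ := hH.bounded
  obtain ⟨M, hM⟩ := isCompact_Icc.exists_bound_of_continuousOn hf
  refine ⟨⟨|M| * C, by positivity, fun s hs i => ?_⟩, ?_⟩
  · rw [Pi.smul_apply, smul_eq_mul, abs_mul]
    exact mul_le_mul ((hM s hs).trans (le_abs_self M)) (hC s hs i) (abs_nonneg _) (abs_nonneg _)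
  · filter_upwards [hH.leftCont] with s h hs
    exact (tendsto_of_continuousOn_Icc hf hs).smul (h hs)

theorem IsRegular.vecMul (hH : IsRegular a b H) {A : ℝ → Matrix (Fin d) (Fin d) ℝ}
    (hA : ContinuousOn A (Icc a b)) : IsRegular a b fun s => H s ᵥ* A s := by
  obtain ⟨C, hC0, hC⟩ := hH.bounded
  have hA' : ∀ i j, ∃ M, ∀ s ∈ Icc a b, ‖A s i j‖ ≤ M := fun i j =>
    isCompact_Icc.exists_bound_of_continuousOn
      ((continuous_id.matrix_elem i j).comp_continuousOn hA)
  choose M hM using hA'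
  refine ⟨⟨∑ j, ∑ i, C * |M i j|, by positivity, fun s hs j => ?_⟩, ?_⟩
  · refine le_trans ?_ (Finset.single_le_sum (f := fun j => ∑ i, C * |M i j|)
      (fun _ _ => Finset.sum_nonneg fun _ _ => by positivity) (Finset.mem_univ j))
    simp only [Matrix.vecMul, dotProduct]
    refine (Finset.abs_sum_le_sum_abs _ _).trans (Finset.sum_le_sum fun i _ => ?_)
    rw [abs_mul]
    exact mul_le_mul (hC s hs i) ((hM i j s hs).trans (le_abs_self _)) (abs_nonneg _) hC0
  · filter_upwards [hH.leftCont] with s h hs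
    have hc : Continuous fun p : (Fin d → ℝ) × Matrix (Fin d) (Fin d) ℝ => p.1 ᵥ* p.2 := by
      fun_prop
    have hc' := hc.tendsto (H s, A s)
    exact hc'.comp ((h hs).prodMk_nhds (tendsto_of_continuousOn_Icc hA hs))

theorem innerR_indicator_left (s : Set ℝ) (φ ψ : ℝ → Fin d → ℝ) (x : ℝ) :
    innerR R (s.indicator φ x) (ψ x) = s.indicator (fun x => innerR R (φ x) (ψ x)) x := by
  by_cases h : x ∈ s <;> simp [h, innerR_zero_left]

theorem innerR_indicator_self (s : Set ℝ) (φ : ℝ → Fin d → ℝ) (x : ℝ) :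
    innerR R (s.indicator φ x) (s.indicator φ x) =
      s.indicator (fun x => innerR R (φ x) (φ x)) x := by
  by_cases h : x ∈ s <;> simp [h, innerR_zero_left]

/-- The Cauchy–Schwarz inequality on an interval. -/
theorem sq_intervalIntegral_le (hab : a ≤ b) {g : ℝ → ℝ}
    (hg : IntegrableOn g (Ioc a b)) (hg2 : IntegrableOn (fun x => g x ^ 2) (Ioc a b)) :
    (∫ x in Ioc a b, g x) ^ 2 ≤ (b - a) * ∫ x in Ioc a b, g x ^ 2 := by
  rcases hab.eq_or_lt with rfl | hlt
  · simp
  set L := b - a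
  have hL : 0 < L := sub_pos.2 hlt
  set c := ∫ x in Ioc a b, g x
  have e : ∀ x, (L * g x - c) ^ 2 = L ^ 2 * g x ^ 2 - (2 * L * c) * g x + c ^ 2 := fun x => by ring
  have h0 : 0 ≤ ∫ x in Ioc a b, (L * g x - c) ^ 2 := integral_nonneg fun x => sq_nonneg _
  have i1 : IntegrableOn (fun x => L ^ 2 * g x ^ 2) (Ioc a b) := hg2.const_mul _
  have i2 : IntegrableOn (fun x => (2 * L * c) * g x) (Ioc a b) := hg.const_mul _
  have i12 : IntegrableOn (fun x => L ^ 2 * g x ^ 2 - (2 * L * c) * g x) (Ioc a b) := i1.sub i2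
  simp_rw [e] at h0
  rw [integral_add i12 (integrableOn_const (by simp)), integral_sub i1 i2, integral_const_mul,
    integral_const_mul, setIntegral_const, measureReal_def, Real.volume_Ioc,
    ENNReal.toReal_ofReal hL.le, smul_eq_mul] at h0
  have h1 : 0 ≤ L * (L * (∫ x in Ioc a b, g x ^ 2) - c ^ 2) := by
    calc (0 : ℝ) ≤ _ := h0
      _ = _ := by ring
  linarith [nonneg_of_mul_nonneg_right h1 hL]

variable [mΩ : MeasurableSpace Ω] {P : Measure Ω}
  {ℱ : Filtration ℝ mΩ} {W : ℝ → Ω → Fin d → ℝ}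

theorem IsWienerIntegral.integrable_mul_indicator (ha : 0 ≤ a) (hab : a ≤ b)
    (hH : IsRegular a b H) {ψ : ℝ → Fin d → ℝ} {ξ : Ω → ℝ} (hξ : IsWienerIntegral P W ψ ξ) :
    IntervalIntegrable (fun x => innerR R (H x) (ψ x)) volume a b := by
  obtain ⟨-, D, hD, -⟩ := hξ
  have h := (approximates_riemannStep (ha := ha) (hab := hab) hH le_rfl).integrable_innerR R hD
  simp_rw [innerR_indicator_left] at h
  rw [intervalIntegrable_iff_integrableOn_Ioc_of_le hab]
  exact (integrable_indicator_iff measurableSet_Ioc).1 h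

/-- The second moments of the Wiener integrals `I s = ∫ₐˢ H · dW` are bounded by that of `I b`. -/
theorem integral_sq_le_of_isWienerIntegral (hW : IsBrownianMotion P ℱ R W) (hR : R.PosDef)
    (hab : a ≤ b) {I : ℝ → Ω → ℝ}
    (hI : ∀ s ∈ Icc a b, IsWienerIntegral P W ((Ioc a s).indicator H) (I s)) {s : ℝ}
    (hs : s ∈ Icc a b) : ∫ ω, I s ω * I s ω ∂P ≤ ∫ ω, I b ω * I b ω ∂P := by
  have hbmem : b ∈ Icc a b := ⟨hab, le_rfl⟩
  rw [(hI s hs).integral_mul hW hR (hI s hs), (hI b hbmem).integral_mul hW hR (hI b hbmem)]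
  have hint := (hI b hbmem).2.choose_spec.1.integrable_innerR R (hI b hbmem).2.choose_spec.1
  have hints := (hI s hs).2.choose_spec.1.integrable_innerR R (hI s hs).2.choose_spec.1
  refine integral_mono hints hint fun x => ?_
  simp only [innerR_indicator_self]
  exact indicator_le_indicator_of_subset (Ioc_subset_Ioc_right hs.2)
    (fun x => innerR_self_nonneg hR _) x

/-- The process `g s * I s` is square integrable over `(a, b] × Ω`, which justifies every exchange
of time integrals and expectations below. -/
theorem memLp_weight_mul [IsProbabilityMeasure P] (hW : IsBrownianMotion P ℱ R W)
    (hR : R.PosDef) (hab : a ≤ b) {I : ℝ → Ω → ℝ}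
    (hI : ∀ s ∈ Icc a b, IsWienerIntegral P W ((Ioc a s).indicator H) (I s))
    (hIm : AEStronglyMeasurable (Function.uncurry I) ((volume.restrict (Ioc a b)).prod P))
    {g : ℝ → ℝ} (hg : Continuous g) :
    MemLp (fun z : ℝ × Ω => g z.1 * I z.1 z.2) 2 ((volume.restrict (Ioc a b)).prod P) := by
  obtain ⟨M, hM⟩ := isCompact_Icc.exists_bound_of_continuousOn (hg.continuousOn (s := Icc a b))
  have hgm : AEStronglyMeasurable (fun z : ℝ × Ω => g z.1 * I z.1 z.2)
      ((volume.restrict (Ioc a b)).prod P) :=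
    (hg.measurable.comp measurable_fst).aestronglyMeasurable.mul hIm
  have hmem : ∀ᵐ q ∂(volume.restrict (Ioc a b)), q ∈ Ioc a b := ae_restrict_mem measurableSet_Ioc
  rw [memLp_two_iff_integrable_sq hgm]
  refine (integrable_prod_iff (hgm.pow 2)).2 ⟨?_, ?_⟩
  · filter_upwards [hmem] with q hq
    exact ((hI q ⟨hq.1.le, hq.2⟩).1.const_mul (g q)).integrable_sq
  · refine Integrable.of_bound (hgm.pow 2).norm.integral_prod_right'
      (M ^ 2 * ∫ ω, I b ω * I b ω ∂P) ?_
    filter_upwards [hmem] with q hq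
    rw [Real.norm_of_nonneg (integral_nonneg fun _ => norm_nonneg _)]
    have e : ∀ ω, ‖((fun z : ℝ × Ω => g z.1 * I z.1 z.2) ^ 2) (q, ω)‖ =
        g q ^ 2 * (I q ω * I q ω) := fun ω => by
      rw [Pi.pow_apply, Real.norm_of_nonneg (sq_nonneg _)]; ring
    rw [integral_congr_ae (.of_forall e), integral_const_mul]
    have h1 : g q ^ 2 ≤ M ^ 2 := sq_le_sq' (by
      have := hM q ⟨hq.1.le, hq.2⟩
      rw [Real.norm_eq_abs] at this
      exact neg_le_of_abs_le this) (le_of_abs_le (hM q ⟨hq.1.le, hq.2⟩))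
    exact mul_le_mul h1 (integral_sq_le_of_isWienerIntegral hW hR hab hI ⟨hq.1.le, hq.2⟩)
      (integral_nonneg fun ω => mul_self_nonneg _) (sq_nonneg _)

/-- A weighted time average of the Wiener integrals `I s = ∫ₐˢ H · dW` is again a Wiener integral.
The weight is the derivative of `f`. -/
theorem isWienerIntegral_average [IsProbabilityMeasure P] (hW : IsBrownianMotion P ℱ R W) (hR : R.PosDef) (ha : 0 ≤ a)
    (hab : a ≤ b) (hH : IsRegular a b H) {I : ℝ → Ω → ℝ}
    (hI : ∀ s ∈ Icc a b, IsWienerIntegral P W ((Ioc a s).indicator H) (I s))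
    (hIm : AEStronglyMeasurable (Function.uncurry I) ((volume.restrict (Ioc a b)).prod P))
    {f f' : ℝ → ℝ} (hf : ∀ x, HasDerivAt f (f' x) x) (hf' : Continuous f') :
    IsWienerIntegral P W ((Ioc a b).indicator fun q => (1 + f b - f q) • H q)
      (fun ω => I b ω + ∫ q in a..b, f' q * I q ω) := by
  set μ : Measure ℝ := volume.restrict (Ioc a b) with hμ
  have hbmem : b ∈ Icc a b := ⟨hab, le_rfl⟩
  have hfc : Continuous f := continuous_iff_continuousAt.2 fun x => (hf x).continuousAt
  obtain ⟨K, hK, -⟩ := (approximates_riemannStep (ha := ha) (hab := hab)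
    (hH.smul (f := fun q => 1 + f b - f q) (by fun_prop)) le_rfl).exists_isWienerIntegral hW hR
  have hgm : AEStronglyMeasurable (fun z : ℝ × Ω => f' z.1 * I z.1 z.2) (μ.prod P) :=
    (hf'.measurable.comp measurable_fst).aestronglyMeasurable.mul hIm
  have hg2 : MemLp (fun z : ℝ × Ω => f' z.1 * I z.1 z.2) 2 (μ.prod P) :=
    memLp_weight_mul hW hR hab hI hIm hf'
  set J : Ω → ℝ := fun ω => I b ω + ∫ q in a..b, f' q * I q ω with hJ
  have hJe : ∀ ω, J ω = I b ω + ∫ q, f' q * I q ω ∂μ := fun ω => by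
    rw [hJ, hμ, ← intervalIntegral.integral_of_le hab]
  -- testing `J` against a square integrable variable
  have hF : ∀ ξ : Ω → ℝ, MemLp ξ 2 P → ∫ ω, J ω * ξ ω ∂P =
      ∫ ω, I b ω * ξ ω ∂P + ∫ q in a..b, f' q * ∫ ω, I q ω * ξ ω ∂P := by
    intro ξ hξ
    have hp : Integrable (fun z : ℝ × Ω => f' z.1 * I z.1 z.2 * ξ z.2) (μ.prod P) :=
      hg2.integrable_mul (hξ.comp_snd μ)
    have e : ∀ ω, J ω * ξ ω = I b ω * ξ ω + ∫ q, f' q * I q ω * ξ ω ∂μ := fun ω => by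
      rw [hJe, add_mul, integral_mul_const]
    have i1 : Integrable (fun ω => I b ω * ξ ω) P := (hI b hbmem).1.integrable_mul hξ
    have i2 : Integrable (fun ω => ∫ q, f' q * I q ω * ξ ω ∂μ) P := hp.integral_prod_right
    simp_rw [e]
    rw [integral_add i1 i2, intervalIntegral.integral_of_le hab,
      integral_integral_swap (f := fun ω q => f' q * I q ω * ξ ω) hp.swap]
    congr 1
    refine integral_congr_ae (.of_forall fun q => ?_)
    simp only [mul_assoc]
    rw [integral_const_mul]
  have hJ2 : MemLp J 2 P := by
    refine ((hI b hbmem).1.add (g := fun ω => ∫ q, f' q * I q ω ∂μ) ?_).ae_eq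
      (.of_forall fun ω => (hJe ω).symm)
    have hm : AEStronglyMeasurable (fun ω => ∫ q, f' q * I q ω ∂μ) P :=
      hgm.prod_swap.integral_prod_right'
    rw [memLp_two_iff_integrable_sq hm]
    have h2 : Integrable (fun z : ℝ × Ω => (f' z.1 * I z.1 z.2) ^ 2) (μ.prod P) :=
      hg2.integrable_sq
    have h1 : Integrable (fun z : ℝ × Ω => f' z.1 * I z.1 z.2) (μ.prod P) :=
      hg2.integrable one_le_two
    refine (h2.integral_prod_right.const_mul (b - a)).mono' (hm.pow 2) ?_
    filter_upwards [h2.prod_left_ae, h1.prod_left_ae] with ω hω2 hω1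
    rw [Real.norm_of_nonneg (sq_nonneg _)]
    exact sq_intervalIntegral_le hab hω1 hω2
  -- on Wiener integrals, `J` acts as `K`
  have hJK : ∀ (ψ : ℝ → Fin d → ℝ) (ξ : Ω → ℝ), IsWienerIntegral P W ψ ξ →
      ∫ ω, J ω * ξ ω ∂P = ∫ ω, K ω * ξ ω ∂P := by
    intro ψ ξ hξ
    have hy := hξ.integrable_mul_indicator (R := R) ha hab hH
    have e : ∀ s ∈ Icc a b, ∫ ω, I s ω * ξ ω ∂P = ∫ x in a..s, innerR R (H x) (ψ x) := by
      intro s hs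
      rw [(hI s hs).integral_mul hW hR hξ]
      simp_rw [innerR_indicator_left]
      rw [integral_indicator measurableSet_Ioc, intervalIntegral.integral_of_le hs.1]
    rw [hF ξ hξ.1, hK.integral_mul hW hR hξ, e b hbmem]
    simp_rw [innerR_indicator_left, innerR_smul_left]
    rw [integral_indicator measurableSet_Ioc, ← intervalIntegral.integral_of_le hab]
    have e2 : ∫ q in a..b, f' q * ∫ ω, I q ω * ξ ω ∂P =
        ∫ q in a..b, f' q * ∫ x in a..q, innerR R (H x) (ψ x) := by
      refine intervalIntegral.integral_congr fun q hq => ?_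
      rw [uIcc_of_le hab] at hq
      simp only [e q hq]
    rw [e2, integral_deriv_mul_primitive hf hf' hy, ← intervalIntegral.integral_add hy
      (hy.continuousOn_mul (by fun_prop))]
    congr 1
    ext x
    ring
  -- `J` is not yet known to be a Wiener integral, but it is an average of such
  have hJJ : ∫ ω, J ω * J ω ∂P = ∫ ω, J ω * K ω ∂P := by
    rw [hF J hJ2, hF K hK.1]
    have e : ∀ s ∈ Icc a b, ∫ ω, I s ω * J ω ∂P = ∫ ω, I s ω * K ω ∂P := fun s hs => by
      have := hJK _ _ (hI s hs)
      simp_rw [mul_comm (I s _)]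
      exact this
    rw [e b hbmem]
    congr 1
    refine intervalIntegral.integral_congr fun q hq => ?_
    rw [uIcc_of_le hab] at hq
    simp only [e q hq]
  have hKK := hJK _ _ hK
  refine hK.congr_ae ?_
  have e : ∀ ω, (K ω - J ω) ^ 2 = J ω * J ω - 2 * (J ω * K ω) + K ω * K ω := fun ω => by ring
  have i1 : Integrable (fun ω => J ω * J ω) P := hJ2.integrable_mul hJ2
  have i2 : Integrable (fun ω => 2 * (J ω * K ω)) P := (hJ2.integrable_mul hK.1).const_mul 2
  have i3 : Integrable (fun ω => K ω * K ω) P := hK.1.integrable_mul hK.1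
  have i12 : Integrable (fun ω => J ω * J ω - 2 * (J ω * K ω)) P := i1.sub i2
  have h0 : ∫ ω, (K ω - J ω) ^ 2 ∂P = 0 := by
    simp_rw [e]
    rw [integral_add i12 i3, integral_sub i1 i2, integral_const_mul, hJJ, hKK]
    ring
  have h1 := (integral_eq_zero_iff_of_nonneg (fun ω => sq_nonneg (K ω - J ω))
    (hK.1.sub hJ2).integrable_sq).1 h0
  filter_upwards [h1] with ω hω
  exact sub_eq_zero.1 (pow_eq_zero_iff two_ne_zero |>.1 hω)

end Fubini

/-! ### The law of the terminal wealth under a deterministic control -/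

section TerminalWealth

variable {Ω : Type*} {d : ℕ} [mΩ : MeasurableSpace Ω] {P : Measure Ω} {ℱ : Filtration ℝ mΩ}
  {W : ℝ → Ω → Fin d → ℝ}

theorem measurable_intervalIntegral {Ω : Type*} {m : MeasurableSpace Ω} {X : ℝ → Ω → ℝ}
    (hX : Measurable (Function.uncurry X)) (t : ℝ) :
    Measurable fun z : ℝ × Ω => ∫ p in t..z.1, X p z.2 := by
  have h : ∀ l u : ℝ × Ω → ℝ, Measurable l → Measurable u →
      Measurable fun z : ℝ × Ω => ∫ p in Ioc (l z) (u z), X p z.2 := by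
    intro l u hl hu
    simp_rw [← integral_indicator measurableSet_Ioc]
    have hs : MeasurableSet {w : (ℝ × Ω) × ℝ | w.2 ∈ Ioc (l w.1) (u w.1)} :=
      (measurableSet_lt (hl.comp measurable_fst) measurable_snd).inter
        (measurableSet_le measurable_snd (hu.comp measurable_fst))
    have hm : Measurable fun w : (ℝ × Ω) × ℝ =>
        (Ioc (l w.1) (u w.1)).indicator (fun p => X p w.1.2) w.2 := by
      exact (hX.comp (measurable_snd.prodMk (measurable_snd.comp measurable_fst))).indicator hs
    exact hm.stronglyMeasurable.integral_prod_right'.measurable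
  exact (h _ _ measurable_const measurable_fst).sub (h _ _ measurable_fst measurable_const)

theorem IsRegular.intervalIntegrable_sum {a b : ℝ} {v : ℝ → Fin d → ℝ} (ha : 0 ≤ a)
    (hab : a ≤ b) (hv : IsRegular a b v) {c : ℝ → Fin d → ℝ} (hc : ContinuousOn c (Icc a b)) :
    IntervalIntegrable (fun s => ∑ i, v s i * c s i) volume a b := by
  have h : IntervalIntegrable (∑ i, fun s => v s i * c s i) volume a b :=
    IntervalIntegrable.sum _ fun i _ =>
      (hv.intervalIntegrable_apply ha hab i).mul_continuousOn (by
        rw [uIcc_of_le hab]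
        exact (continuous_apply i).comp_continuousOn hc)
  refine h.congr fun s _ => ?_
  simp

theorem hasDerivAt_neg_exp (r T q : ℝ) :
    HasDerivAt (fun q => -Real.exp (r * (T - q))) (r * Real.exp (r * (T - q))) q := by
  have h := (((hasDerivAt_id' q).const_sub T).const_mul r).exp.neg
  exact h.congr_deriv (by ring)

variable {mk : Market d}

theorem continuousOn_premium (mk : Market d) {t : ℝ} (ht : 0 ≤ t) :
    ContinuousOn (fun s i => mk.μ s i - mk.r) (Icc t mk.T) :=
  (mk.μ_cont.mono (Icc_subset_Icc_left ht)).sub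
    (g := fun _ _ => mk.r) continuousOn_const

/-- The terminal gain over the riskless investment is its mean plus the Wiener integral of
`vₛᵀ σₛ e^{r(T-s)}`. The wealth equation is linear, so the gain is a time average of the Itô
integral in it. -/
theorem IsWealth.isWienerIntegral_terminal [IsProbabilityMeasure P]
    (hW : IsBrownianMotion P ℱ mk.R W) {v : ℝ → Fin d → ℝ} {t x : ℝ} {X : ℝ → Ω → ℝ}
    (ht : t ∈ Ico 0 mk.T) (hv : IsRegular t mk.T v)
    (hX : IsWealth mk P ℱ W (fun s _ => v s) t x X) :
    IsWienerIntegral P W ((Ioc t mk.T).indicator fun q => volVec mk q (v q))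
      (fun ω => X mk.T ω - x * Real.exp (mk.r * (mk.T - t)) - driftInt mk v t) := by
  have htT : t ≤ mk.T := ht.2.le
  set T := mk.T
  set r := mk.r
  set H : ℝ → Fin d → ℝ := fun q => v q ᵥ* mk.σ q with hHdef
  have hH : IsRegular t T H := hv.vecMul (mk.σ_cont.mono (Icc_subset_Icc_left ht.1))
  set a : ℝ → ℝ := fun q => ∑ i, v q i * (mk.μ q i - r) with hadef
  have ha : IntervalIntegrable a volume t T :=
    hv.intervalIntegrable_sum ht.1 htT (continuousOn_premium mk ht.1)
  have hsub : ∀ s ∈ Icc t T, uIcc t s ⊆ uIcc t T := fun s hs => by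
    rw [uIcc_of_le hs.1, uIcc_of_le htT]; exact Icc_subset_Icc_right hs.2
  set I : ℝ → Ω → ℝ := fun s ω =>
    X s ω - x - (r * (∫ q in t..s, X q ω) + ∫ q in t..s, a q) with hIdef
  have hI : ∀ s ∈ Icc t T, IsWienerIntegral P W ((Ioc t s).indicator H) (I s) := by
    intro s hs
    have hsde := hX.sde s hs
    have happ := approximates_riemannStep (ha := ht.1) (hab := hs.1)
      (hH.mono le_rfl hs.2) (le_refl s)
    refine (happ.isWienerIntegral_of_tendstoInMeasure hW mk.R_posDef (ξ := fun ω => X s ω - x -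
        ∫ q in t..s, (r * X q ω + a q)) ?_).congr_ae ?_
    · refine hsde.congr_left fun n => .of_forall fun ω => ?_
      exact (riemannStep_integral (W := W) (ha := ht.1) (hab := hs.1) (H := H) n ω).symm
    · filter_upwards [hX.integrable_paths] with ω hω
      rw [hIdef, intervalIntegral.integral_add ((hω.mono_set (hsub s hs)).const_mul r)
        (ha.mono_set (hsub s hs)), intervalIntegral.integral_const_mul]
  have hIm : AEStronglyMeasurable (Function.uncurry I)
      ((volume.restrict (Ioc t T)).prod P) := by
    have h1 : Measurable fun z : ℝ × Ω => X z.1 z.2 := hX.measurable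
    have h2 : Measurable fun z : ℝ × Ω => ∫ q in t..z.1, X q z.2 :=
      measurable_intervalIntegral hX.measurable t
    have h3 : AEStronglyMeasurable (fun s => ∫ q in t..s, a q) (volume.restrict (Ioc t T)) := by
      have hc := (ha.absolutelyContinuousOnInterval_intervalIntegral (c := t) (by simp)).continuousOn
      rw [uIcc_of_le htT] at hc
      exact (hc.mono Ioc_subset_Icc_self).aestronglyMeasurable measurableSet_Ioc
    exact (h1.aestronglyMeasurable.sub aestronglyMeasurable_const).sub
      ((h2.aestronglyMeasurable.const_mul r).add h3.comp_fst)
  have key := isWienerIntegral_average hW mk.R_posDef ht.1 htT hH hI hIm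
    (hasDerivAt_neg_exp r T) (by fun_prop)
  have e1 : (fun q => (1 + -Real.exp (r * (T - T)) - -Real.exp (r * (T - q))) • H q) =
      fun q => volVec mk q (v q) := by
    funext q
    rw [volVec, sub_self, mul_zero, Real.exp_zero]
    congr 1
    ring
  rw [e1] at key
  refine key.congr_ae ?_
  filter_upwards [hX.integrable_paths] with ω hω
  have i0 : Continuous fun q => r * Real.exp (r * (T - q)) := by fun_prop
  have hcX : ContinuousOn (fun q => ∫ p in t..q, X p ω) (uIcc t T) :=
    (hω.absolutelyContinuousOnInterval_intervalIntegral (c := t) (by simp)).continuousOn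
  have hca : ContinuousOn (fun q => ∫ p in t..q, a p) (uIcc t T) :=
    (ha.absolutelyContinuousOnInterval_intervalIntegral (c := t) (by simp)).continuousOn
  have j1 : IntervalIntegrable (fun q => r * Real.exp (r * (T - q)) * X q ω) volume t T :=
    hω.continuousOn_mul i0.continuousOn
  have j2 : IntervalIntegrable (fun q => r * Real.exp (r * (T - q)) * x) volume t T :=
    (by fun_prop : Continuous fun q => r * Real.exp (r * (T - q)) * x).intervalIntegrable _ _
  have j3 : IntervalIntegrable (fun q => r * Real.exp (r * (T - q)) * ∫ p in t..q, X p ω)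
      volume t T := (i0.continuousOn.mul hcX).intervalIntegrable
  have j4 : IntervalIntegrable (fun q => r * Real.exp (r * (T - q)) * ∫ p in t..q, a p)
      volume t T := (i0.continuousOn.mul hca).intervalIntegrable
  have hexp : ∫ q in t..T, r * Real.exp (r * (T - q)) * I q ω =
      (∫ q in t..T, r * Real.exp (r * (T - q)) * X q ω) -
        (∫ q in t..T, r * Real.exp (r * (T - q)) * x) -
        (r * (∫ q in t..T, r * Real.exp (r * (T - q)) * ∫ p in t..q, X p ω) +
          ∫ q in t..T, r * Real.exp (r * (T - q)) * ∫ p in t..q, a p) := by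
    rw [← intervalIntegral.integral_const_mul, ← intervalIntegral.integral_sub j1 j2,
      ← intervalIntegral.integral_add (j3.const_mul r) j4,
      ← intervalIntegral.integral_sub (j1.sub j2) ((j3.const_mul r).add j4)]
    congr 1
    ext q
    rw [hIdef]
    ring
  have hx : ∫ q in t..T, r * Real.exp (r * (T - q)) * x = (-1 + Real.exp (r * (T - t))) * x := by
    rw [intervalIntegral.integral_mul_const, intervalIntegral.integral_eq_sub_of_hasDerivAt
      (fun q _ => hasDerivAt_neg_exp r T q) (i0.intervalIntegrable _ _)]
    simp
  have hprim : ∀ y : ℝ → ℝ, IntervalIntegrable y volume t T →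
      ∫ q in t..T, r * Real.exp (r * (T - q)) * ∫ p in t..q, y p =
        (∫ q in t..T, Real.exp (r * (T - q)) * y q) - ∫ q in t..T, y q := by
    intro y hy
    rw [integral_deriv_mul_primitive (hasDerivAt_neg_exp r T) i0 hy,
      ← intervalIntegral.integral_sub
        (hy.continuousOn_mul (by fun_prop : Continuous _).continuousOn) hy]
    congr 1
    ext q
    rw [sub_self, mul_zero, Real.exp_zero]
    ring
  have hd : driftInt mk v t = ∫ q in t..T, Real.exp (r * (T - q)) * a q := by
    rw [driftInt]
    congr 1
    ext q
    rw [hadef, Finset.mul_sum]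
    refine Finset.sum_congr rfl fun i _ => ?_
    rw [excess]
    ring
  have hlast : ∫ q in t..T, r * Real.exp (r * (T - q)) * X q ω =
      r * ∫ q in t..T, Real.exp (r * (T - q)) * X q ω := by
    rw [← intervalIntegral.integral_const_mul]
    simp_rw [mul_assoc]
  rw [hexp, hx, hprim _ hω, hprim _ ha, hd, hlast, hIdef]
  ring

/-- `volNorm²` without the square root. -/
theorem volNorm_sq (mk : Market d) (v : ℝ → Fin d → ℝ) {t : ℝ} (ht : t ≤ mk.T) :
    volNorm mk v t ^ 2 = ∫ s in t..mk.T, innerR mk.R (volVec mk s (v s)) (volVec mk s (v s)) :=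
  Real.sq_sqrt (intervalIntegral.integral_nonneg ht fun _ _ => innerR_self_nonneg mk.R_posDef _)

theorem IsWealth.map_terminal [IsProbabilityMeasure P]
    (hW : IsBrownianMotion P ℱ mk.R W) {v : ℝ → Fin d → ℝ} {t x : ℝ} {X : ℝ → Ω → ℝ}
    (ht : t ∈ Ico 0 mk.T) (hv : IsRegular t mk.T v)
    (hX : IsWealth mk P ℱ W (fun s _ => v s) t x X) :
    P.map (fun ω => X mk.T ω - x * Real.exp (mk.r * (mk.T - t))) =
      gaussianReal (driftInt mk v t) (Real.toNNReal (volNorm mk v t ^ 2)) := by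
  have h := hX.isWienerIntegral_terminal hW ht hv
  have hlaw := h.map_eq hW mk.R_posDef
  simp_rw [innerR_indicator_self] at hlaw
  rw [integral_indicator measurableSet_Ioc, ← intervalIntegral.integral_of_le ht.2.le,
    ← volNorm_sq mk v ht.2.le] at hlaw
  have h2 := gaussianReal_add_const ⟨h.1.1.aemeasurable, hlaw⟩ (driftInt mk v t)
  simpa using h2.map_eq

end TerminalWealth

/-! ### Existence of the wealth process under a deterministic control -/

section Existence

variable {d : ℕ} {a b : ℝ} {H : ℝ → Fin d → ℝ}

/-- The Riemann sums truncated at `min s u` involve `W` only up to time `u`, so they are jointly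
measurable for the information `m` available at time `u`. -/
theorem measurable_riemannStep_integral {Ω : Type*} {m : MeasurableSpace Ω}
    {W : ℝ → Ω → Fin d → ℝ} (ha : 0 ≤ a) (hab : a ≤ b) {u : ℝ}
    (hW : ∀ s, 0 ≤ s → s ≤ u → Measurable (W s)) (n : ℕ) :
    Measurable fun z : ℝ × Ω =>
      (riemannStep a b ha hab H (min z.1 u) n).integral W z.2 := by
  change Measurable fun z : ℝ × Ω => ∑ i ∈ Finset.range n,
    (riemannStep a b ha hab H (min z.1 u) n).c i ⬝ᵥ
      (W ((riemannStep a b ha hab H (min z.1 u) n).p (i + 1)) z.2 -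
        W ((riemannStep a b ha hab H (min z.1 u) n).p i) z.2)
  refine Finset.measurable_sum _ fun i _ => ?_
  set p : ℕ → ℝ := (riemannStep a b ha hab H b n).p with hp
  have h0 : ∀ j, 0 ≤ p j := (riemannStep a b ha hab H b n).p_nonneg
  have hle : p i ≤ p (i + 1) := (riemannStep a b ha hab H b n).p_le_succ i
  have e : (fun z : ℝ × Ω => (riemannStep a b ha hab H (min z.1 u) n).c i ⬝ᵥ
      (W ((riemannStep a b ha hab H (min z.1 u) n).p (i + 1)) z.2 -
        W ((riemannStep a b ha hab H (min z.1 u) n).p i) z.2)) =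
      {z : ℝ × Ω | p (i + 1) ≤ min z.1 u}.indicator fun z =>
        H (p i) ⬝ᵥ (W (p (i + 1)) z.2 - W (p i) z.2) := by
    funext z
    rcases le_or_gt (p (i + 1)) (min z.1 u) with h | h
    · rw [indicator_of_mem (show z ∈ {z : ℝ × Ω | p (i + 1) ≤ min z.1 u} from h),
        riemannStep_c_of_le h]
      rfl
    · rw [indicator_of_notMem (show z ∉ {z : ℝ × Ω | p (i + 1) ≤ min z.1 u} from h.not_ge),
        riemannStep_c_of_lt h, zero_dotProduct]
  rw [e]
  rcases le_or_gt (p (i + 1)) u with h | h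
  · refine Measurable.indicator ?_ (measurableSet_le measurable_const
      (measurable_fst.min measurable_const))
    exact (measurable_dotProduct_left ((hW _ (h0 _) h).sub (hW _ (h0 _) (hle.trans h)))
      (H (p i))).comp measurable_snd
  · have : {z : ℝ × Ω | p (i + 1) ≤ min z.1 u} = ∅ :=
      eq_empty_of_forall_notMem fun z hz => h.not_ge (hz.trans (min_le_right _ _))
    rw [this, indicator_empty]
    exact measurable_const

theorem measurable_limsup_riemannStep {Ω : Type*} {m : MeasurableSpace Ω}
    {W : ℝ → Ω → Fin d → ℝ} (ha : 0 ≤ a) (hab : a ≤ b) {u : ℝ}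
    (hW : ∀ s, 0 ≤ s → s ≤ u → Measurable (W s)) (ns : ℕ → ℕ) :
    Measurable fun z : ℝ × Ω =>
      limsup (fun k => (riemannStep a b ha hab H (min z.1 u) (ns k)).integral W z.2) atTop :=
  .limsup fun k => measurable_riemannStep_integral ha hab hW (ns k)

variable {Ω : Type*} [mΩ : MeasurableSpace Ω] {P : Measure Ω} {ℱ : Filtration ℝ mΩ}
  {R : Matrix (Fin d) (Fin d) ℝ} {W : ℝ → Ω → Fin d → ℝ}

/-- Convergence in `L²` at a summable rate is convergence almost everywhere. -/
theorem ae_tendsto_of_summable_sq {f : ℕ → Ω → ℝ} {g : Ω → ℝ} {δ : ℕ → ℝ}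
    (hf : ∀ k, MemLp (f k) 2 P) (hg : MemLp g 2 P) (hδ : Summable δ)
    (h : ∀ k, ∫ ω, (f k ω - g ω) ^ 2 ∂P ≤ δ k) :
    ∀ᵐ ω ∂P, Tendsto (fun k => f k ω) atTop (𝓝 (g ω)) := by
  have hint : ∀ k, Integrable (fun ω => (f k ω - g ω) ^ 2) P := fun k =>
    ((hf k).sub hg).integrable_sq
  have hδ0 : ∀ k, 0 ≤ δ k := fun k => (integral_nonneg fun ω => sq_nonneg _).trans (h k)
  have hlt : ∫⁻ ω, ∑' k, ENNReal.ofReal ((f k ω - g ω) ^ 2) ∂P ≠ ⊤ := by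
    rw [lintegral_tsum fun k => (hint k).aestronglyMeasurable.aemeasurable.ennreal_ofReal]
    have h1 : ∀ k, ∫⁻ ω, ENNReal.ofReal ((f k ω - g ω) ^ 2) ∂P ≤ ENNReal.ofReal (δ k) := fun k => by
      rw [← ofReal_integral_eq_lintegral_ofReal (hint k) (.of_forall fun ω => sq_nonneg _)]
      exact ENNReal.ofReal_le_ofReal (h k)
    refine ne_top_of_le_ne_top ?_ (ENNReal.tsum_le_tsum h1)
    rw [← ENNReal.ofReal_tsum_of_nonneg hδ0 hδ]
    exact ENNReal.ofReal_ne_top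
  have hae := ae_lt_top' (AEMeasurable.tsum fun k =>
    (hint k).aestronglyMeasurable.aemeasurable.ennreal_ofReal) hlt
  filter_upwards [hae] with ω hω
  have h1 := ENNReal.tendsto_atTop_zero_of_tsum_ne_top hω.ne
  have h2 := ((ENNReal.tendsto_toReal ENNReal.zero_ne_top).comp h1).sqrt
  simp only [Function.comp_def, ENNReal.toReal_ofReal (sq_nonneg _), Real.sqrt_sq_eq_abs,
    ENNReal.toReal_zero, Real.sqrt_zero] at h2
  exact tendsto_sub_nhds_zero_iff.1 (tendsto_zero_iff_abs_tendsto_zero _ |>.2 h2)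

theorem IsWienerIntegral.ae_unique (hW : IsBrownianMotion P ℱ R W) (hR : R.PosDef)
    {φ : ℝ → Fin d → ℝ} {ξ η : Ω → ℝ} (hξ : IsWienerIntegral P W φ ξ)
    (hη : IsWienerIntegral P W φ η) : ξ =ᵐ[P] η := by
  have h := hξ.integral_sq_sub hW hR hη
  simp only [sub_self, innerR_zero_left, integral_zero] at h
  have h1 := (integral_eq_zero_iff_of_nonneg (fun ω => sq_nonneg (ξ ω - η ω))
    (hξ.1.sub hη.1).integrable_sq).1 h
  filter_upwards [h1] with ω hω
  exact sub_eq_zero.1 (pow_eq_zero_iff two_ne_zero |>.1 hω)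

/-- The Wiener integrals over `(a, s]` have a version, as a process in `s`, that is progressively
measurable. -/
theorem exists_progressive_wiener (hW : IsBrownianMotion P ℱ R W) (hR : R.PosDef) (ha : 0 ≤ a)
    (hab : a ≤ b) (hH : IsRegular a b H) :
    ∃ I : ℝ → Ω → ℝ,
      (∀ s ∈ Icc a b, IsWienerIntegral P W ((Ioc a s).indicator H) (I s)) ∧
      ∀ u, 0 ≤ u → Measurable[Prod.instMeasurableSpace (m₂ := ℱ u)]
        fun z : ℝ × Ω => I (min z.1 u) z.2 := by
  obtain ⟨ε, hε, hle⟩ := exists_riemannStep_uniform hW hR ha hab hH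
  obtain ⟨ns, -, hns⟩ := extraction_forall_of_eventually
    (P := fun k n => n ≠ 0 ∧ ε n ≤ (1 / 2 : ℝ) ^ k) fun k =>
      (eventually_ne_atTop 0).and
        ((hε.eventually (gt_mem_nhds (by positivity : (0 : ℝ) < (1 / 2) ^ k))).mono
          fun n hn => hn.le)
  refine ⟨fun s ω => limsup (fun k => (riemannStep a b ha hab H s (ns k)).integral W ω) atTop,
    fun s hs => ?_, fun u hu => ?_⟩
  · obtain ⟨ξ, hξ, -⟩ := (approximates_riemannStep (ha := ha) (hab := hab) hH
      hs.2).exists_isWienerIntegral hW hR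
    refine hξ.congr_ae ?_
    have h := ae_tendsto_of_summable_sq (P := P) (g := ξ)
      (f := fun k => (riemannStep a b ha hab H s (ns k)).integral W)
      (fun k => StepIntegrand.memLp_integral _ hW) hξ.1 summable_geometric_two
      fun k => (hle _ (hns k).1 s hs.2 ξ hξ).trans (hns k).2
    filter_upwards [h] with ω hω
    exact hω.limsup_eq.symm
  · exact measurable_limsup_riemannStep (m := ℱ u) ha hab
      (fun s hs hsu => (hW.adapted s hs).mono (ℱ.mono hsu) le_rfl) ns

variable {mk : Market d}

theorem measurable_wealth_integrand {Ω : Type*} {m : MeasurableSpace Ω} {A : ℝ → ℝ}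
    (hA : Measurable A) {I : ℝ → Ω → ℝ} {κ : ℝ → ℝ} (hκ : Measurable κ) {u : ℝ}
    (hI : Measurable fun z : ℝ × Ω => I (min z.1 u) z.2) (r : ℝ) :
    Measurable (Function.uncurry fun p ω => Real.exp (-(r * p)) * (A p + I (min (κ p) u) ω)) := by
  have h1 : Measurable fun z : ℝ × Ω => I (min (κ z.1) u) z.2 :=
    hI.comp ((hκ.comp measurable_fst).prodMk measurable_snd)
  have h2 : Measurable fun z : ℝ × Ω => Real.exp (-(r * z.1)) := by fun_prop
  exact h2.mul ((hA.comp measurable_fst).add h1)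

/-- Joint measurability of the variation-of-constants formula. The σ-algebra `m` on `Ω` is arbitrary:
with `m = ℱ u` the lemma gives adaptedness. -/
theorem measurable_wealth {Ω : Type*} {m : MeasurableSpace Ω} {A : ℝ → ℝ}
    (hA : Measurable A) {I : ℝ → Ω → ℝ} {κ : ℝ → ℝ} (hκ : Measurable κ) {u : ℝ}
    (hI : Measurable fun z : ℝ × Ω => I (min z.1 u) z.2) (r t : ℝ) :
    Measurable (Function.uncurry fun s ω => A s + I (min (κ s) u) ω + r * Real.exp (r * s) *
      ∫ p in t..s, Real.exp (-(r * p)) * (A p + I (min (κ p) u) ω)) := by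
  have h1 : Measurable fun z : ℝ × Ω => I (min (κ z.1) u) z.2 :=
    hI.comp ((hκ.comp measurable_fst).prodMk measurable_snd)
  have h2 : Measurable fun z : ℝ × Ω => r * Real.exp (r * z.1) := by fun_prop
  exact ((hA.comp measurable_fst).add h1).add (h2.mul
    (measurable_intervalIntegral (measurable_wealth_integrand hA hκ hI r) t))

/-- Variation of constants: for deterministic controls the wealth equation has a solution. -/
theorem exists_isWealth [IsProbabilityMeasure P] (hW : IsBrownianMotion P ℱ mk.R W)
    {v : ℝ → Fin d → ℝ} {t : ℝ} (x : ℝ) (ht : t ∈ Ico 0 mk.T) (hv : IsRegular t mk.T v) :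
    ∃ X, IsWealth mk P ℱ W (fun s _ => v s) t x X := by
  have htT : t ≤ mk.T := ht.2.le
  set T := mk.T
  set r := mk.r
  set H : ℝ → Fin d → ℝ := fun q => v q ᵥ* mk.σ q with hHdef
  have hH : IsRegular t T H := hv.vecMul (mk.σ_cont.mono (Icc_subset_Icc_left ht.1))
  set a : ℝ → ℝ := fun q => ∑ i, v q i * (mk.μ q i - r) with hadef
  have ha : IntervalIntegrable a volume t T :=
    hv.intervalIntegrable_sum ht.1 htT (continuousOn_premium mk ht.1)
  obtain ⟨I, hI, hIm⟩ := exists_progressive_wiener hW mk.R_posDef ht.1 htT hH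
  -- outside `[t, T]` all processes are frozen
  set κ : ℝ → ℝ := fun q => max t (min q T) with hκdef
  have hκc : Continuous κ := by fun_prop
  have hκmem : ∀ q, κ q ∈ Icc t T := fun q => ⟨le_max_left _ _, max_le htT (min_le_right _ _)⟩
  have hκeq : ∀ q ∈ Icc t T, κ q = q := fun q hq => by
    rw [hκdef]
    simp only [min_eq_left hq.2, max_eq_right hq.1]
  set A : ℝ → ℝ := fun q => x + ∫ p in t..κ q, a p with hAdef
  have hac : ContinuousOn (fun s => ∫ p in t..s, a p) (Icc t T) := by
    have := (ha.absolutelyContinuousOnInterval_intervalIntegral (c := t) (by simp)).continuousOn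
    rwa [uIcc_of_le htT] at this
  have hA : Continuous A := continuous_const.add (hac.comp_continuous hκc hκmem)
  set y : ℝ → Ω → ℝ := fun p ω => Real.exp (-(r * p)) * (A p + I (min (κ p) T) ω) with hydef
  set X : ℝ → Ω → ℝ := fun s ω =>
    A s + I (min (κ s) T) ω + r * Real.exp (r * s) * ∫ p in t..s, y p ω with hXdef
  have hminT : ∀ s ∈ Icc t T, ∀ u, s ≤ u → min (κ s) u = s := fun s hs u hu => by
    rw [hκeq s hs, min_eq_left hu]
  -- almost every path of the integrand is integrable
  have hIint : ∀ᵐ ω ∂P, IntervalIntegrable (fun s => I (min (κ s) T) ω) volume t T := by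
    have hm : Measurable fun z : ℝ × Ω => I (min (κ z.1) T) z.2 := by
      have h1 : Measurable fun z : ℝ × Ω => I (min z.1 T) z.2 :=
        (hIm T mk.T_pos.le).mono (sup_le_sup_left (MeasurableSpace.comap_mono (ℱ.le T)) _) le_rfl
      exact h1.comp ((hκc.measurable.comp measurable_fst).prodMk measurable_snd)
    have hI' : ∀ s ∈ Icc t T, IsWienerIntegral P W ((Ioc t s).indicator H)
        ((fun s ω => I (min (κ s) T) ω) s) := fun s hs => by
      simp only [hminT s hs T hs.2]
      exact hI s hs
    have h2 := (memLp_weight_mul hW mk.R_posDef htT (I := fun s ω => I (min (κ s) T) ω) hI'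
      hm.aestronglyMeasurable
      (g := fun _ => 1) continuous_const).integrable one_le_two
    simp only [one_mul] at h2
    filter_upwards [h2.prod_left_ae] with ω hω
    rw [intervalIntegrable_iff_integrableOn_Ioc_of_le htT]
    exact hω
  have hyint : ∀ᵐ ω ∂P, IntervalIntegrable (fun s => y s ω) volume t T := by
    filter_upwards [hIint] with ω hω
    exact ((hA.intervalIntegrable _ _).add hω).continuousOn_mul
      (by fun_prop : Continuous fun p => Real.exp (-(r * p))).continuousOn
  have hc1 : Continuous fun q => Real.exp (r * q) := by fun_prop
  have hc2 : Continuous fun q => r * Real.exp (r * q) := by fun_prop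
  have hXy : ∀ s ω, X s ω =
      Real.exp (r * s) * y s ω + r * Real.exp (r * s) * ∫ p in t..s, y p ω := fun s ω => by
    rw [hXdef, hydef]
    simp only
    rw [← mul_assoc, ← Real.exp_add, add_neg_cancel, Real.exp_zero, one_mul]
  have hpint : ∀ ω, IntervalIntegrable (fun s => y s ω) volume t T →
      IntervalIntegrable (fun q => r * Real.exp (r * q) * ∫ p in t..q, y p ω) volume t T :=
    fun ω hω => (hc2.continuousOn.mul
      (hω.absolutelyContinuousOnInterval_intervalIntegral (c := t) (by simp)).continuousOn
      ).intervalIntegrable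
  have hsub : ∀ s ∈ Icc t T, uIcc t s ⊆ uIcc t T := fun s hs => by
    rw [uIcc_of_le hs.1, uIcc_of_le htT]; exact Icc_subset_Icc_right hs.2
  have hXint : ∀ᵐ ω ∂P, IntervalIntegrable (fun s => X s ω) volume t T := by
    filter_upwards [hyint] with ω hω
    simp_rw [hXy]
    exact (hω.continuousOn_mul hc1.continuousOn).add (hpint ω hω)
  -- the isometry over the empty interval `(t, t]` gives the initial condition
  have hI0 : I t =ᵐ[P] 0 := by
    have h := (hI t ⟨le_rfl, htT⟩).integral_mul hW mk.R_posDef (hI t ⟨le_rfl, htT⟩)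
    simp only [Ioc_self, indicator_empty, innerR_zero_left, integral_zero] at h
    have h1 := (integral_eq_zero_iff_of_nonneg (fun ω => mul_self_nonneg (I t ω))
      ((hI t ⟨le_rfl, htT⟩).1.integrable_mul (hI t ⟨le_rfl, htT⟩).1)).1 h
    filter_upwards [h1] with ω hω
    exact mul_self_eq_zero.1 hω
  refine ⟨X, ?_, ?_, hXint, ?_, ?_⟩
  · intro s hs
    have hs0 : 0 ≤ s := ht.1.trans hs.1
    have h := measurable_wealth (m := ℱ s) hA.measurable hκc.measurable (hIm s hs0) r t
    have h' : Measurable[ℱ s] _ := Measurable.of_uncurry_left h (x := s)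
    have e : X s = fun ω => A s + I (min (κ s) s) ω + r * Real.exp (r * s) *
        ∫ p in t..s, Real.exp (-(r * p)) * (A p + I (min (κ p) s) ω) := by
      funext ω
      rw [hXdef]
      simp only
      rw [hminT s hs T hs.2, hminT s hs s le_rfl]
      congr 2
      refine intervalIntegral.integral_congr fun p hp => ?_
      rw [uIcc_of_le hs.1] at hp
      have hp' : p ∈ Icc t T := ⟨hp.1, hp.2.trans hs.2⟩
      simp only [hydef]
      rw [hminT p hp' T hp'.2, hminT p hp' s hp.2]
    rw [e]
    exact h'
  · exact (measurable_wealth (m := ℱ T) hA.measurable hκc.measurable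
      (hIm T mk.T_pos.le) r t).mono
        (sup_le_sup_left (MeasurableSpace.comap_mono (ℱ.le T)) _) le_rfl
  · filter_upwards [hI0] with ω hω
    rw [hXdef]
    simp only
    rw [hminT t ⟨le_rfl, htT⟩ T htT, hω, hAdef]
    simp only
    rw [hκeq t ⟨le_rfl, htT⟩, intervalIntegral.integral_same, intervalIntegral.integral_same]
    simp
  · intro s hs
    have happ := approximates_riemannStep (ha := ht.1) (hab := hs.1)
      (hH.mono le_rfl hs.2) (le_refl s)
    obtain ⟨η, hη, hlim⟩ := happ.exists_isWienerIntegral hW mk.R_posDef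
    have hmeas := tendstoInMeasure_of_tendsto_eLpNorm two_ne_zero
      (fun n => (StepIntegrand.memLp_integral _ hW).1) hη.1.1 hlim
    refine (hmeas.congr_left fun n => .of_forall fun ω =>
      riemannStep_integral (W := W) (ha := ht.1) (hab := hs.1) (H := H) n ω).congr_right ?_
    refine (hη.ae_unique hW mk.R_posDef (hI s hs)).trans ?_
    filter_upwards [hyint, hXint] with ω hω hωX
    have hω' := hω.mono_set (hsub s hs)
    have i1 : IntervalIntegrable (fun q => Real.exp (r * q) * y q ω) volume t s :=
      hω'.continuousOn_mul hc1.continuousOn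
    have hder : ∀ q, HasDerivAt (fun q => Real.exp (r * q)) (r * Real.exp (r * q)) q := fun q =>
      (((hasDerivAt_id' q).const_mul r).exp).congr_deriv (by ring)
    have hXs : ∫ q in t..s, X q ω = Real.exp (r * s) * ∫ q in t..s, y q ω := by
      simp_rw [hXy]
      rw [intervalIntegral.integral_add i1 ((hpint ω hω).mono_set (hsub s hs)),
        integral_deriv_mul_primitive hder hc2 hω']
      simp_rw [sub_mul]
      rw [intervalIntegral.integral_sub (hω'.const_mul _) i1, intervalIntegral.integral_const_mul]
      ring
    rw [intervalIntegral.integral_add ((hωX.mono_set (hsub s hs)).const_mul r)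
        (ha.mono_set (hsub s hs)), intervalIntegral.integral_const_mul, hXs, hXdef]
    simp only
    rw [hminT s hs T hs.2, hAdef]
    simp only
    rw [hκeq s hs]
    ring

end Existence

/-! ### The reward of a deterministic control -/

section Reward

variable {Ω : Type*} {d : ℕ} [mΩ : MeasurableSpace Ω] {P : Measure Ω} {ℱ : Filtration ℝ mΩ}
  {W : ℝ → Ω → Fin d → ℝ} {mk : Market d}

/-- The reward of a Gaussian gain with mean `A` and variance `V`, for the penalty weight `l`, the
indicator `c` of cash-invariance and the risk `ϱ` of a standard normal position. -/
noncomputable def gaussianReward (β γ : ℝ) (F : ℝ → ℝ) (l c ϱ A V : ℝ) : ℝ :=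
  1 / β * (1 - Real.exp (-γ * A + γ ^ 2 / 2 * V)) - l * F (-(c * A) + ϱ * Real.sqrt V)

theorem RiskMeasure.coe_normalRisk {T : ℝ} (ρ : RiskMeasure P ℱ T) (h : ρ.normalRisk ≠ ⊤) :
    ((ρ.normalRisk.toReal : ℝ) : EReal) = ρ.normalRisk := by
  refine EReal.coe_toReal h ?_
  unfold RiskMeasure.normalRisk RiskMeasure.onLaw at h ⊢
  split_ifs at h ⊢ with hex
  · exact ρ.ne_bot _ hex.choose_spec.1
  · exact absurd rfl h

/-- The risk of a nondegenerate Gaussian position. -/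
theorem RiskMeasure.toFun_gaussian [IsProbabilityMeasure P] {T : ℝ} (ρ : RiskMeasure P ℱ T)
    (hρ : ρ.CashInvariant ∨ ρ.ShiftInvariant) (hfin : ρ.normalRisk ≠ ⊤) {G : Ω → ℝ}
    (hG : SqIntegrable P ℱ T G) {A B : ℝ} (hB : 0 < B)
    (hlaw : P.map G = gaussianReal A (Real.toNNReal (B ^ 2))) :
    ρ.toFun G = ((-(ρ.cashInd * A) + ρ.normalRisk.toReal * B : ℝ) : EReal) := by
  set Z : Ω → ℝ := fun ω => B⁻¹ * (G ω - A) with hZdef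
  have hmem : MemLp (fun ω => G ω - A) 2 P := hG.2.sub (memLp_const A)
  have hZ : SqIntegrable P ℱ T Z := ⟨(hG.1.sub_const A).const_mul _, hmem.const_mul _⟩
  have hBZ : SqIntegrable P ℱ T fun ω => B * Z ω := ⟨hZ.1.const_mul _, hZ.2.const_mul _⟩
  have hlawZ : P.map Z = gaussianReal 0 1 := by
    have h := gaussianReal_const_mul (gaussianReal_sub_const
      ⟨hG.2.1.aemeasurable, hlaw⟩ A) B⁻¹
    rw [hZdef, h.map_eq, sub_self, mul_zero]
    congr 1
    ext
    simp only [NNReal.coe_mul, NNReal.coe_mk, Real.coe_toNNReal _ (sq_nonneg B), NNReal.coe_one]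
    field_simp
  have hGZ : G = fun ω => B * Z ω + A := by
    funext ω
    simp only [hZdef]
    field_simp
    ring
  have hρZ : ρ.toFun (fun ω => B * Z ω) = ((ρ.normalRisk.toReal * B : ℝ) : EReal) := by
    rw [ρ.pos_homogeneous Z hZ B hB.le, ← ρ.onLaw_map hZ, hlawZ, mul_comm, EReal.coe_mul,
      ρ.coe_normalRisk hfin]
    rfl
  by_cases hc : ρ.CashInvariant
  · rw [RiskMeasure.cashInd, if_pos hc, hGZ, hc _ hBZ, hρZ, ← EReal.coe_sub]
    congr 1
    ring
  · rw [RiskMeasure.cashInd, if_neg hc, hGZ, (hρ.resolve_left hc) _ hBZ, hρZ]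
    congr 1
    ring

/-- The reward of a deterministic control is an explicit function of the mean and the variance of
the gain. -/
theorem reward_eq_gaussianReward [IsProbabilityMeasure P] (hW : IsBrownianMotion P ℱ mk.R W)
    (ρ : RiskMeasure P ℱ mk.T) (hρ : ρ.CashInvariant ∨ ρ.ShiftInvariant)
    (hfin : ρ.normalRisk ≠ ⊤) (F lam : ℝ → ℝ) (β γ : ℝ)
    {v : ℝ → Fin d → ℝ} {t x : ℝ} {X : ℝ → Ω → ℝ}
    (ht : t ∈ Ico 0 mk.T) (hv : IsRegular t mk.T v)
    (hX : IsWealth mk P ℱ W (fun s _ => v s) t x X) (hB : 0 < volNorm mk v t) :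
    reward mk P ρ (expTarget β γ) F lam t x X =
      ((gaussianReward β γ F (lam t) ρ.cashInd ρ.normalRisk.toReal (driftInt mk v t)
        (volNorm mk v t ^ 2) : ℝ) : EReal) := by
  set G : Ω → ℝ := fun ω => X mk.T ω - x * Real.exp (mk.r * (mk.T - t)) with hGdef
  have hlaw : P.map G = gaussianReal _ _ := hX.map_terminal hW ht hv
  have hGm : Measurable[ℱ mk.T] G := (hX.adapted mk.T ⟨ht.2.le, le_rfl⟩).sub_const _
  have hGm' : Measurable G := hGm.mono (ℱ.le _) le_rfl
  have hG2 : MemLp G 2 P := by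
    have h := memLp_id_gaussianReal' (μ := driftInt mk v t)
      (v := Real.toNNReal (volNorm mk v t ^ 2)) 2 (by simp)
    rw [← hlaw] at h
    exact (memLp_map_measure_iff (by fun_prop) hGm'.aemeasurable).1 h
  have hexp : ∫ ω, expTarget β γ (G ω) ∂P =
      1 / β * (1 - Real.exp (-γ * driftInt mk v t + γ ^ 2 / 2 * volNorm mk v t ^ 2)) := by
    have hi : Integrable (fun ω => Real.exp (-γ * G ω)) P := by
      have h := integrable_exp_mul_gaussianReal (μ := driftInt mk v t)
        (v := Real.toNNReal (volNorm mk v t ^ 2)) (-γ)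
      rw [← hlaw] at h
      exact (integrable_map_measure (by fun_prop) hGm'.aemeasurable).1 h
    have hm := mgf_gaussianReal hlaw (-γ)
    simp only [mgf] at hm
    simp only [expTarget]
    rw [integral_const_mul, integral_sub (integrable_const 1) hi, hm,
      Real.coe_toNNReal _ (sq_nonneg _)]
    simp only [integral_const, probReal_univ, smul_eq_mul, mul_one]
    ring_nf
  have hrisk := ρ.toFun_gaussian hρ hfin ⟨hGm, hG2⟩ hB hlaw
  unfold reward gaussianReward
  rw [hrisk, extend, if_neg (EReal.coe_ne_top _), EReal.toReal_coe, hexp,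
    Real.sqrt_sq hB.le, EReal.coe_sub, EReal.coe_mul (lam t)]

end Reward

/-! ### Deterministic controls and their splices -/

section Controls

variable {Ω : Type*} {d : ℕ} [mΩ : MeasurableSpace Ω] {P : Measure Ω} {ℱ : Filtration ℝ mΩ}
  {mk : Market d}

theorem isRegular_of_continuousOn {a b : ℝ} {v : ℝ → Fin d → ℝ} (hv : ContinuousOn v (Icc a b)) :
    IsRegular a b v := by
  obtain ⟨M, hM⟩ := isCompact_Icc.exists_bound_of_continuousOn hv
  refine ⟨⟨|M|, abs_nonneg _, fun s hs i => ?_⟩, .of_forall fun s hs =>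
    tendsto_of_continuousOn_Icc hv hs⟩
  exact (norm_le_pi_norm (v s) i).trans ((hM s hs).trans (le_abs_self M))

theorem isRegular_of_admissible [Nonempty Ω] {v : ℝ → Fin d → ℝ}
    (hv : (fun s (_ : Ω) => v s) ∈ admissibleControls mk ℱ) {t : ℝ} (ht : 0 ≤ t) :
    IsRegular t mk.T v := by
  obtain ⟨ω⟩ := ‹Nonempty Ω›
  refine ⟨⟨mk.M, mk.M_pos.le, fun s hs i => hv.2.2 s ⟨ht.trans hs.1, hs.2⟩ ω i⟩,
    .of_forall fun s hs => ?_⟩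
  exact tendsto_pi_nhds.2 fun i => (hv.2.1 ω i).1 s ⟨ht.trans_lt hs.1, hs.2⟩

theorem continuous_mem_admissible {û : ℝ → Fin d → ℝ} (hû : ContinuousOn û (Icc 0 mk.T))
    (hûM : ∀ t ∈ Icc 0 mk.T, ∀ i, |û t i| ≤ mk.M) :
    (fun s (_ : Ω) => û s) ∈ admissibleControls mk ℱ := by
  refine ⟨fun s _ => measurable_const, fun ω i => ⟨fun s hs => ?_, fun s hs => ⟨û s i, ?_⟩⟩,
    fun s hs _ i => hûM s hs i⟩
  · exact tendsto_of_continuousOn_Icc ((continuous_apply i).comp_continuousOn hû) hs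
  · have h := (hû s ⟨hs.1, hs.2.le⟩).tendsto
    refine (((continuous_apply i).tendsto _).comp h).mono_left ?_
    rw [← nhdsWithin_Ioo_eq_nhdsGT hs.2]
    exact nhdsWithin_mono _ fun y hy => ⟨hs.1.trans hy.1.le, hy.2.le⟩

/-- Splices at `c` remain regular, although left-continuity may fail at the single time `c`. -/
theorem isRegular_splice {a b c : ℝ} {u v : ℝ → Fin d → ℝ} (hu : IsRegular a b u)
    (hv : IsRegular a b v) : IsRegular a b fun s => if s < c then v s else u s := by
  obtain ⟨C, hC0, hC⟩ := hu.bounded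
  obtain ⟨C', hC0', hC'⟩ := hv.bounded
  refine ⟨⟨max C C', le_max_of_le_left hC0, fun s hs i => ?_⟩, ?_⟩
  · split_ifs
    · exact (hC' s hs i).trans (le_max_right _ _)
    · exact (hC s hs i).trans (le_max_left _ _)
  · have hne : ∀ᵐ x : ℝ, x ≠ c := by simp [ae_iff]
    filter_upwards [hu.leftCont, hv.leftCont, hne] with s hsu hsv hsc hs
    rcases lt_or_gt_of_ne hsc with h | h
    · rw [if_pos h]
      refine (hsv hs).congr' ?_
      filter_upwards [self_mem_nhdsWithin] with y hy
      rw [if_pos (lt_trans hy h)]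
    · rw [if_neg h.not_gt]
      refine (hsu hs).congr' ?_
      filter_upwards [Ioo_mem_nhdsLT h] with y hy
      rw [if_neg hy.1.not_gt]

/-- An integral under a spliced control differs from the original one by an integral over
`[t, t + h]`. -/
theorem integral_splice {p q : ℝ → ℝ} {t T h : ℝ} (hp : IntervalIntegrable p volume t T)
    (hq : IntervalIntegrable q volume t T) (hh : h ∈ Ioc 0 (T - t)) :
    ∫ s in t..T, (if s < t + h then p s else q s) =
      (∫ s in t..T, q s) + ∫ s in t..t + h, (p s - q s) := by
  have h1 : t ≤ t + h := by linarith [hh.1]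
  have h2 : t + h ≤ T := by linarith [hh.2]
  have hs1 : uIcc t (t + h) ⊆ uIcc t T := by
    rw [uIcc_of_le h1, uIcc_of_le (h1.trans h2)]; exact Icc_subset_Icc_right h2
  have hs2 : uIcc (t + h) T ⊆ uIcc t T := by
    rw [uIcc_of_le h2, uIcc_of_le (h1.trans h2)]; exact Icc_subset_Icc_left h1
  have hne : ∀ᵐ x : ℝ, x ≠ t + h := by simp [ae_iff]
  have e1 : ∀ᵐ s, s ∈ uIoc t (t + h) → (if s < t + h then p s else q s) = p s := by
    filter_upwards [hne] with s hs hsm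
    rw [uIoc_of_le h1] at hsm
    exact if_pos (lt_of_le_of_ne hsm.2 hs)
  have e2 : ∀ s ∈ uIoc (t + h) T, (if s < t + h then p s else q s) = q s := by
    intro s hsm
    rw [uIoc_of_le h2] at hsm
    exact if_neg hsm.1.not_gt
  have i1 : IntervalIntegrable (fun s => if s < t + h then p s else q s) volume t (t + h) :=
    (hp.mono_set hs1).congr_ae ((ae_restrict_iff' measurableSet_uIoc).2
      (e1.mono fun s hs hsm => (hs hsm).symm))
  have i2 : IntervalIntegrable (fun s => if s < t + h then p s else q s) volume (t + h) T :=
    (hq.mono_set hs2).congr fun s hs => (e2 s hs).symm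
  rw [← intervalIntegral.integral_add_adjacent_intervals i1 i2,
    ← intervalIntegral.integral_add_adjacent_intervals (hq.mono_set hs1) (hq.mono_set hs2),
    intervalIntegral.integral_congr_ae e1,
    intervalIntegral.integral_congr_ae (.of_forall e2),
    intervalIntegral.integral_sub (hp.mono_set hs1) (hq.mono_set hs1)]
  ring

/-- The right derivative of a primitive at its base point, for an integrand with a right limit. -/
theorem hasDerivWithinAt_primitive {g : ℝ → ℝ} {t T g₀ : ℝ} (htT : t < T)
    (hg : IntervalIntegrable g volume t T) (hlim : Tendsto g (𝓝[>] t) (𝓝 g₀)) :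
    HasDerivWithinAt (fun u => ∫ s in t..u, g s) g₀ (Ici t) t := by
  refine intervalIntegral.integral_hasDerivWithinAt_of_tendsto_ae_right (t := Ioi t)
    IntervalIntegrable.refl ?_ (hlim.mono_left inf_le_left)
  refine ⟨Ioc t T, Ioc_mem_nhdsGT htT, ?_⟩
  exact ((intervalIntegrable_iff_integrableOn_Ioc_of_le htT.le).1 hg).aestronglyMeasurable

theorem tendsto_div_of_hasDerivWithinAt {f : ℝ → ℝ} {t f' : ℝ}
    (hf : HasDerivWithinAt f f' (Ici t) t) :
    Tendsto (fun h => (f (t + h) - f t) / h) (𝓝[>] 0) (𝓝 f') := by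
  have h1 := (hasDerivWithinAt_iff_tendsto_slope' (notMem_Ioi.2 le_rfl)).1
    (hf.mono Ioi_subset_Ici_self)
  have h2 : Tendsto (fun h : ℝ => t + h) (𝓝[>] 0) (𝓝[>] t) := by
    refine tendsto_nhdsWithin_iff.2 ⟨?_, ?_⟩
    · have : Tendsto (fun h : ℝ => t + h) (𝓝 0) (𝓝 (t + 0)) := by
        exact (continuous_const.add continuous_id).tendsto 0
      rw [add_zero] at this
      exact this.mono_left nhdsWithin_le_nhds
    · filter_upwards [self_mem_nhdsWithin] with h hh
      exact lt_add_of_pos_right t hh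
  refine (h1.comp h2).congr fun h => ?_
  simp only [Function.comp_apply, slope_def_field, add_sub_cancel_left]

end Controls

/-! ### The first-order expression -/

section FirstOrder

variable {d : ℕ} {mk : Market d}

theorem volVec_sub (s : ℝ) (x y : Fin d → ℝ) :
    volVec mk s (x - y) = volVec mk s x - volVec mk s y := by
  rw [volVec, volVec, volVec, Matrix.sub_vecMul, smul_sub]

theorem volVec_smul (s c : ℝ) (x : Fin d → ℝ) : volVec mk s (c • x) = c • volVec mk s x := by
  rw [volVec, volVec, Matrix.smul_vecMul, smul_comm]

theorem innerR_volVec_eq_sum (s : ℝ) (x : Fin d → ℝ) (y : Fin d → ℝ) :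
    innerR mk.R x (volVec mk s y) = ∑ k, y k * innerR mk.R x (volRow mk s k) := by
  have h : volVec mk s y = ∑ k, y k • volRow mk s k := by
    ext j
    simp only [volVec, volRow, Pi.smul_apply, Finset.sum_apply, Matrix.vecMul, dotProduct,
      smul_eq_mul, Finset.mul_sum]
    exact Finset.sum_congr rfl fun k _ => by ring
  rw [h, innerR_sum_right]
  simp_rw [innerR_smul_right]

theorem eq_zero_of_volVec_eq_zero {s : ℝ} (hs : s ∈ Icc 0 mk.T) {y : Fin d → ℝ}
    (h : volVec mk s y = 0) : y = 0 := by
  have h1 : y ᵥ* mk.σ s = 0 := (smul_eq_zero.1 h).resolve_left (Real.exp_pos _).ne'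
  by_contra hy
  have h2 := (mk.σ_posDef s hs).dotProduct_mulVec_pos hy
  rw [star_trivial, Matrix.dotProduct_mulVec, h1, zero_dotProduct] at h2
  exact lt_irrefl _ h2

/-- The concavity constant of the reward in the current value of the control: the first-order
expression is affine in this value, with linear part `-curvature * ⟨·, σᵏ·⟩_R`. -/
noncomputable def curvature (mk : Market d) (β γ : ℝ) (F lam : ℝ → ℝ) (c ϱ : ℝ)
    (û : ℝ → Fin d → ℝ) (t : ℝ) : ℝ :=
  1 / β * Real.exp (-γ * driftInt mk û t + γ ^ 2 / 2 * volNorm mk û t ^ 2) * γ ^ 2 +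
    lam t * deriv F (-(c * driftInt mk û t) + ϱ * volNorm mk û t) * (ϱ / volNorm mk û t)

variable {β γ : ℝ} {F lam : ℝ → ℝ} {c ϱ : ℝ} {û : ℝ → Fin d → ℝ} {t : ℝ}

theorem curvature_pos (hβ : 0 < β) (hγ : 0 < γ) (hF : Monotone F) (hlam : 0 ≤ lam t)
    (hϱ : 0 ≤ ϱ) : 0 < curvature mk β γ F lam c ϱ û t := by
  have h1 : 0 ≤ deriv F (-(c * driftInt mk û t) + ϱ * volNorm mk û t) := hF.deriv_nonneg
  have h2 : 0 ≤ volNorm mk û t := Real.sqrt_nonneg _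
  unfold curvature
  positivity

/-- The first-order expression is affine in the current value of the control. -/
theorem firstOrder_sub_firstOrder (w w' : Fin d → ℝ) (k : Fin d) :
    firstOrder mk β γ F lam c ϱ û t w k - firstOrder mk β γ F lam c ϱ û t w' k =
      -curvature mk β γ F lam c ϱ û t *
        innerR mk.R (volVec mk t (w - w')) (volRow mk t k) := by
  rw [volVec_sub, innerR_sub_left]
  unfold firstOrder curvature
  ring

theorem sum_mul_firstOrder (w y : Fin d → ℝ) :
    ∑ k, y k * firstOrder mk β γ F lam c ϱ û t w k =
      -(1 / β) * Real.exp (-γ * driftInt mk û t + γ ^ 2 / 2 * volNorm mk û t ^ 2) *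
        (-γ * (∑ k, y k * excess mk t k) +
          γ ^ 2 * innerR mk.R (volVec mk t w) (volVec mk t y)) -
      lam t * deriv F (-(c * driftInt mk û t) + ϱ * volNorm mk û t) *
        (-(c * ∑ k, y k * excess mk t k) +
          ϱ * (innerR mk.R (volVec mk t w) (volVec mk t y) / volNorm mk û t)) := by
  rw [innerR_volVec_eq_sum]
  simp only [firstOrder, Finset.mul_sum, Finset.sum_div, ← Finset.sum_neg_distrib,
    ← Finset.sum_add_distrib, ← Finset.sum_sub_distrib]
  exact Finset.sum_congr rfl fun k _ => by ring

/-- The first-order system has at most one solution. -/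
theorem firstOrder_unique (hβ : 0 < β) (hγ : 0 < γ) (hF : Monotone F) (ht : t ∈ Icc 0 mk.T)
    (hlam : 0 ≤ lam t) (hϱ : 0 ≤ ϱ) {w w' : Fin d → ℝ}
    (hw : ∀ k, firstOrder mk β γ F lam c ϱ û t w k = 0)
    (hw' : ∀ k, firstOrder mk β γ F lam c ϱ û t w' k = 0) : w = w' := by
  have hκ := curvature_pos (mk := mk) (c := c) (û := û) hβ hγ hF hlam hϱ
  have h : ∀ k, innerR mk.R (volVec mk t (w - w')) (volRow mk t k) = 0 := fun k => by
    have := firstOrder_sub_firstOrder (mk := mk) (β := β) (γ := γ) (F := F) (lam := lam) (c := c)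
      (ϱ := ϱ) (û := û) (t := t) w w' k
    rw [hw, hw', sub_zero, zero_eq_mul] at this
    exact this.resolve_left (neg_ne_zero.2 hκ.ne')
  have h0 : innerR mk.R (volVec mk t (w - w')) (volVec mk t (w - w')) = 0 := by
    rw [innerR_volVec_eq_sum]
    simp [h]
  exact sub_eq_zero.1 (eq_zero_of_volVec_eq_zero ht (innerR_self_eq_zero mk.R_posDef h0))

end FirstOrder

/-! ### The derivative of the reward along a spliced control -/

section Derivative

variable {Ω : Type*} {d : ℕ} [mΩ : MeasurableSpace Ω] {P : Measure Ω} {ℱ : Filtration ℝ mΩ}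
  {W : ℝ → Ω → Fin d → ℝ} {mk : Market d}

theorem hasDerivWithinAt_gaussianReward {β γ l c ϱ : ℝ} {F : ℝ → ℝ} (hF : Differentiable ℝ F)
    {a k : ℝ → ℝ} {a' k' t : ℝ} {s : Set ℝ} (ha : HasDerivWithinAt a a' s t)
    (hk : HasDerivWithinAt k k' s t) (hpos : 0 < k t) :
    HasDerivWithinAt (fun u => gaussianReward β γ F l c ϱ (a u) (k u))
      (-(1 / β) * Real.exp (-γ * a t + γ ^ 2 / 2 * k t) * (-γ * a' + γ ^ 2 / 2 * k') -
        l * deriv F (-(c * a t) + ϱ * Real.sqrt (k t)) *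
          (-(c * a') + ϱ * (k' / (2 * Real.sqrt (k t))))) s t := by
  have h1 := ((((ha.const_mul (-γ)).add (hk.const_mul (γ ^ 2 / 2))).exp).const_sub 1).const_mul
    (1 / β)
  have h2 := ((ha.const_mul c).neg).add ((hk.sqrt hpos.ne').const_mul ϱ)
  have h3 := (((hF _).hasDerivAt).comp_hasDerivWithinAt t h2).const_mul l
  refine (h1.sub h3).congr_deriv ?_
  simp only [Pi.add_apply, Pi.neg_apply]
  ring

theorem continuousOn_excess (mk : Market d) {t : ℝ} (ht : 0 ≤ t) :
    ContinuousOn (fun s => excess mk s) (Icc t mk.T) := by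
  have h := continuousOn_premium mk ht
  refine continuousOn_pi.2 fun i => ?_
  exact ((continuous_apply i).comp_continuousOn h).mul (by fun_prop)

theorem IsRegular.volVec {v : ℝ → Fin d → ℝ} {t : ℝ} (ht : 0 ≤ t) (hv : IsRegular t mk.T v) :
    IsRegular t mk.T fun s => volVec mk s (v s) :=
  (hv.vecMul (mk.σ_cont.mono (Icc_subset_Icc_left ht))).smul
    (f := fun s => Real.exp (mk.r * (mk.T - s))) (by fun_prop)

theorem IsRegular.intervalIntegrable_innerR (R : Matrix (Fin d) (Fin d) ℝ) {a b : ℝ}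
    {H : ℝ → Fin d → ℝ} (ha : 0 ≤ a) (hab : a ≤ b) (hH : IsRegular a b H) :
    IntervalIntegrable (fun s => innerR R (H s) (H s)) volume a b := by
  have happ := approximates_riemannStep (ha := ha) (hab := hab) hH le_rfl
  have h := happ.integrable_innerR R happ
  simp_rw [innerR_indicator_self] at h
  rw [intervalIntegrable_iff_integrableOn_Ioc_of_le hab]
  exact (integrable_indicator_iff measurableSet_Ioc).1 h

theorem tendsto_right_of_continuousOn {E : Type*} [TopologicalSpace E] {f : ℝ → E} {t : ℝ}
    (hf : ContinuousOn f (Icc 0 mk.T)) (ht : t ∈ Ico 0 mk.T) :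
    Tendsto f (𝓝[>] t) (𝓝 (f t)) := by
  refine (hf t ⟨ht.1, ht.2.le⟩).tendsto.mono_left ?_
  rw [← nhdsWithin_Ioo_eq_nhdsGT ht.2]
  exact nhdsWithin_mono _ fun y hy => ⟨ht.1.trans hy.1.le, hy.2.le⟩

theorem tendsto_volVec {v : ℝ → Fin d → ℝ} {w : Fin d → ℝ} {t : ℝ} (ht : t ∈ Ico 0 mk.T)
    (hv : Tendsto v (𝓝[>] t) (𝓝 w)) :
    Tendsto (fun s => volVec mk s (v s)) (𝓝[>] t) (𝓝 (volVec mk t w)) := by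
  have hc : Continuous fun p : ℝ × (Fin d → ℝ) × Matrix (Fin d) (Fin d) ℝ =>
      Real.exp (mk.r * (mk.T - p.1)) • (p.2.1 ᵥ* p.2.2) := by fun_prop
  have h := hc.tendsto (t, w, mk.σ t)
  exact h.comp ((tendsto_id.mono_left nhdsWithin_le_nhds).prodMk_nhds
    (hv.prodMk_nhds (tendsto_right_of_continuousOn mk.σ_cont ht)))

theorem tendsto_sum_mul_excess {v : ℝ → Fin d → ℝ} {w : Fin d → ℝ} {t : ℝ}
    (ht : t ∈ Ico 0 mk.T) (hv : Tendsto v (𝓝[>] t) (𝓝 w)) :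
    Tendsto (fun s => ∑ i, v s i * excess mk s i) (𝓝[>] t) (𝓝 (∑ i, w i * excess mk t i)) := by
  have he := tendsto_right_of_continuousOn (continuousOn_excess mk le_rfl) ht
  exact tendsto_finsetSum _ fun i _ => (tendsto_pi_nhds.1 hv i).mul (tendsto_pi_nhds.1 he i)

/-- The limit of `(J(t, x, û) - J(t, x, u_h)) / h` for a deterministic control `u` whose right
limit at `t` is `w`: a linear term in `w - û t`, given by the first-order expressions, and a
quadratic one. -/
theorem tendsto_reward_quotient [IsProbabilityMeasure P] (hW : IsBrownianMotion P ℱ mk.R W)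
    (ρ : RiskMeasure P ℱ mk.T) (hρ : ρ.CashInvariant ∨ ρ.ShiftInvariant)
    (hfin : ρ.normalRisk ≠ ⊤) {F : ℝ → ℝ} (hF : Differentiable ℝ F) (lam : ℝ → ℝ) (β γ : ℝ)
    {û v : ℝ → Fin d → ℝ} {t x : ℝ} (ht : t ∈ Ico 0 mk.T)
    (hû : ContinuousOn û (Icc 0 mk.T)) (hv : IsRegular t mk.T v) {w : Fin d → ℝ}
    (hvw : Tendsto v (𝓝[>] t) (𝓝 w)) (hB : 0 < volNorm mk û t)
    {X : ℝ → Ω → ℝ} (hX : IsWealth mk P ℱ W (fun s _ => û s) t x X) {Xh : ℝ → ℝ → Ω → ℝ}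
    (hXh : ∀ h ∈ Ioc 0 (mk.T - t),
      IsWealth mk P ℱ W (splice (fun s _ => û s) (fun s _ => v s) t h) t x (Xh h)) :
    Tendsto (fun h : ℝ => (reward mk P ρ (expTarget β γ) F lam t x X -
        reward mk P ρ (expTarget β γ) F lam t x (Xh h)) / (h : EReal)) (𝓝[>] 0)
      (𝓝 ((-(∑ k, (w - û t) k *
          firstOrder mk β γ F lam ρ.cashInd ρ.normalRisk.toReal û t (û t) k) +
        curvature mk β γ F lam ρ.cashInd ρ.normalRisk.toReal û t / 2 *
          innerR mk.R (volVec mk t (w - û t)) (volVec mk t (w - û t)) : ℝ) : EReal)) := by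
  set c := ρ.cashInd
  set ϱ := ρ.normalRisk.toReal
  have htT : t ≤ mk.T := ht.2.le
  have hur : IsRegular t mk.T û :=
    isRegular_of_continuousOn (hû.mono (Icc_subset_Icc_left ht.1))
  have huw := tendsto_right_of_continuousOn hû ht
  set p : (ℝ → Fin d → ℝ) → ℝ → ℝ := fun y s => ∑ i, y s i * excess mk s i with hp
  set q : (ℝ → Fin d → ℝ) → ℝ → ℝ := fun y s =>
    innerR mk.R (volVec mk s (y s)) (volVec mk s (y s)) with hq
  have hpi : ∀ y, IsRegular t mk.T y → IntervalIntegrable (p y) volume t mk.T := fun y hy =>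
    hy.intervalIntegrable_sum ht.1 htT (continuousOn_excess mk ht.1)
  have hqi : ∀ y, IsRegular t mk.T y → IntervalIntegrable (q y) volume t mk.T := fun y hy =>
    (hy.volVec ht.1).intervalIntegrable_innerR mk.R ht.1 htT
  set a : ℝ → ℝ := fun u => driftInt mk û t + ∫ s in t..u, (p v s - p û s) with ha
  set k : ℝ → ℝ := fun u => volNorm mk û t ^ 2 + ∫ s in t..u, (q v s - q û s) with hk
  have had : HasDerivWithinAt a (∑ i, (w - û t) i * excess mk t i) (Ici t) t := by
    refine ((hasDerivWithinAt_primitive ht.2 ((hpi v hv).sub (hpi û hur))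
      ((tendsto_sum_mul_excess ht hvw).sub (tendsto_sum_mul_excess ht huw))).const_add
        _).congr_deriv ?_
    simp only [Pi.sub_apply, sub_mul, Finset.sum_sub_distrib]
  have hkd : HasDerivWithinAt k (2 * innerR mk.R (volVec mk t (û t)) (volVec mk t (w - û t)) +
      innerR mk.R (volVec mk t (w - û t)) (volVec mk t (w - û t))) (Ici t) t := by
    refine ((hasDerivWithinAt_primitive ht.2 ((hqi v hv).sub (hqi û hur))
      ((tendsto_innerR (tendsto_volVec ht hvw) (tendsto_volVec ht hvw)).sub
        (tendsto_innerR (tendsto_volVec ht huw) (tendsto_volVec ht huw)))).const_add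
        _).congr_deriv ?_
    rw [volVec_sub, innerR_self_sub mk.R_posDef]
  have hat : a t = driftInt mk û t := by simp [ha]
  have hkt : k t = volNorm mk û t ^ 2 := by simp [hk]
  have hkpos : 0 < k t := by rw [hkt]; positivity
  -- mean and variance under the spliced control
  have hah : ∀ h ∈ Ioc 0 (mk.T - t),
      driftInt mk (fun s => if s < t + h then v s else û s) t = a (t + h) := by
    intro h hh
    rw [ha]
    simp only [driftInt]
    rw [← integral_splice (hpi v hv) (hpi û hur) hh]
    congr 1
    ext s
    split_ifs <;> rfl
  have hkh : ∀ h ∈ Ioc 0 (mk.T - t),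
      volNorm mk (fun s => if s < t + h then v s else û s) t ^ 2 = k (t + h) := by
    intro h hh
    rw [hk]
    simp only
    rw [volNorm_sq mk _ htT, volNorm_sq mk _ htT]
    rw [← integral_splice (hqi v hv) (hqi û hur) hh]
    congr 1
    ext s
    split_ifs <;> rfl
  have hder := hasDerivWithinAt_gaussianReward (β := β) (γ := γ) (l := lam t) (c := c) (ϱ := ϱ)
    hF had hkd hkpos
  have hlim := (tendsto_div_of_hasDerivWithinAt hder).neg
  have hval : -(-(1 / β) * Real.exp (-γ * a t + γ ^ 2 / 2 * k t) *
        (-γ * (∑ i, (w - û t) i * excess mk t i) + γ ^ 2 / 2 *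
          (2 * innerR mk.R (volVec mk t (û t)) (volVec mk t (w - û t)) +
            innerR mk.R (volVec mk t (w - û t)) (volVec mk t (w - û t)))) -
        lam t * deriv F (-(c * a t) + ϱ * Real.sqrt (k t)) *
          (-(c * ∑ i, (w - û t) i * excess mk t i) + ϱ *
            ((2 * innerR mk.R (volVec mk t (û t)) (volVec mk t (w - û t)) +
              innerR mk.R (volVec mk t (w - û t)) (volVec mk t (w - û t))) /
                (2 * Real.sqrt (k t))))) =
      -(∑ i, (w - û t) i * firstOrder mk β γ F lam c ϱ û t (û t) i) +
        curvature mk β γ F lam c ϱ û t / 2 *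
          innerR mk.R (volVec mk t (w - û t)) (volVec mk t (w - û t)) := by
    rw [sum_mul_firstOrder, curvature, hat, hkt, Real.sqrt_sq hB.le]
    field_simp
    ring
  rw [hval] at hlim
  have hkev : ∀ᶠ h in 𝓝[>] (0 : ℝ), 0 < k (t + h) := by
    have h1 := (tendsto_div_of_hasDerivWithinAt hkd).mul
      (tendsto_id.mono_left nhdsWithin_le_nhds : Tendsto (fun h : ℝ => h) (𝓝[>] 0) (𝓝 0))
    have h2 := h1.add_const (k t)
    rw [mul_zero, zero_add] at h2
    filter_upwards [h2.eventually (lt_mem_nhds hkpos), self_mem_nhdsWithin] with h hh hh0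
    rwa [id, div_mul_cancel₀ _ (ne_of_gt (mem_Ioi.1 hh0)), sub_add_cancel] at hh
  refine (continuous_coe_real_ereal.tendsto _ |>.comp hlim).congr' ?_
  filter_upwards [hkev, Ioc_mem_nhdsGT (sub_pos.2 ht.2)] with h hpos hh
  have hBh : 0 < volNorm mk (fun s => if s < t + h then v s else û s) t := by
    rw [← hkh h hh] at hpos
    exact (Real.sqrt_nonneg _).lt_of_ne fun h0 => hpos.ne' (by
      rw [volNorm, ← h0, zero_pow two_ne_zero])
  rw [reward_eq_gaussianReward hW ρ hρ hfin F lam β γ ht hur hX hB,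
    reward_eq_gaussianReward hW ρ hρ hfin F lam β γ ht (isRegular_splice hur hv) (hXh h hh) hBh,
    hah h hh, hkh h hh, ← hat, ← hkt, ← EReal.coe_sub, ← EReal.coe_div]
  simp only [Function.comp_apply]
  congr 1
  ring

end Derivative

/-! ### Equilibrium and the first-order system -/

section Equilibrium

variable {Ω : Type*} {d : ℕ} [mΩ : MeasurableSpace Ω] {P : Measure Ω} {ℱ : Filtration ℝ mΩ}
  {W : ℝ → Ω → Fin d → ℝ} {mk : Market d}

theorem eq_zero_of_forall_mul_le_sq {G C ε₀ : ℝ} (hε₀ : 0 < ε₀)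
    (h : ∀ ε, |ε| ≤ ε₀ → ε * G ≤ ε ^ 2 * C) : G = 0 := by
  have hlim : ∀ s : ℝ, Tendsto (fun ε : ℝ => s * (ε * C)) (𝓝[>] 0) (𝓝 0) := fun s => by
    have h1 : Continuous fun ε : ℝ => s * (ε * C) := by fun_prop
    have h2 := h1.tendsto 0
    rw [zero_mul, mul_zero] at h2
    exact h2.mono_left nhdsWithin_le_nhds
  refine le_antisymm (ge_of_tendsto (hlim 1) ?_) (le_of_tendsto (hlim (-1)) ?_)
  · filter_upwards [Ioc_mem_nhdsGT hε₀] with ε hε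
    have := h ε (by rw [abs_of_pos hε.1]; exact hε.2)
    have h2 : ε * G ≤ ε * (1 * (ε * C)) := by linarith
    exact le_of_mul_le_mul_left h2 hε.1
  · filter_upwards [Ioc_mem_nhdsGT hε₀] with ε hε
    have := h (-ε) (by rw [abs_neg, abs_of_pos hε.1]; exact hε.2)
    have h2 : ε * (-1 * (ε * C)) ≤ ε * G := by linarith
    exact le_of_mul_le_mul_left h2 hε.1

/-- A constant control is admissible if it respects the bound. -/
theorem const_mem_deterministic {w : Fin d → ℝ} (hw : ∀ i, |w i| ≤ mk.M) :
    (fun (_ : ℝ) (_ : Ω) => w) ∈ deterministicControls mk ℱ :=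
  ⟨⟨fun _ _ => measurable_const, fun _ _ => ⟨fun _ _ => tendsto_const_nhds,
    fun _ _ => ⟨_, tendsto_const_nhds⟩⟩, fun _ _ _ i => hw i⟩, fun _ => w, fun _ _ => rfl⟩

/-- An equilibrium solves the first-order equation of every component that does not touch the
bound: otherwise a small constant deviation in this component would be profitable. -/
theorem firstOrder_eq_zero_of_isNash [IsProbabilityMeasure P]
    (hW : IsBrownianMotion P ℱ mk.R W) (ρ : RiskMeasure P ℱ mk.T)
    (hρ : ρ.CashInvariant ∨ ρ.ShiftInvariant) (hfin : ρ.normalRisk ≠ ⊤) {F : ℝ → ℝ}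
    (hF : Differentiable ℝ F) (lam : ℝ → ℝ) (β γ : ℝ) {û : ℝ → Fin d → ℝ}
    (hû : ContinuousOn û (Icc 0 mk.T)) (hûM : ∀ t ∈ Icc 0 mk.T, ∀ i, |û t i| ≤ mk.M)
    {𝒱 : Set (ℝ → Ω → Fin d → ℝ)} (h𝒱 : deterministicControls mk ℱ ⊆ 𝒱)
    (hN : IsNashEquilibrium mk P ℱ W ρ (expTarget β γ) F lam 𝒱 (fun s _ => û s)) {t : ℝ}
    (ht : t ∈ Ico 0 mk.T) (hB : 0 < volNorm mk û t) {k : Fin d} (hk : |û t k| < mk.M) :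
    firstOrder mk β γ F lam ρ.cashInd ρ.normalRisk.toReal û t (û t) k = 0 := by
  have hur : IsRegular t mk.T û :=
    isRegular_of_continuousOn (hû.mono (Icc_subset_Icc_left ht.1))
  obtain ⟨X, hX⟩ := exists_isWealth hW 0 ht hur
  refine eq_zero_of_forall_mul_le_sq (sub_pos.2 hk)
    (C := curvature mk β γ F lam ρ.cashInd ρ.normalRisk.toReal û t / 2 *
      innerR mk.R (volVec mk t (Pi.single k 1)) (volVec mk t (Pi.single k 1))) fun ε hε => ?_
  set w : Fin d → ℝ := û t + ε • Pi.single k 1 with hw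
  have hwM : ∀ i, |w i| ≤ mk.M := by
    intro i
    by_cases hi : i = k
    · subst hi
      rw [hw]
      simp only [Pi.add_apply, Pi.smul_apply, Pi.single_eq_same, smul_eq_mul, mul_one]
      linarith [abs_add_le (û t i) ε]
    · rw [hw]
      simpa [hi] using hûM t ⟨ht.1, ht.2.le⟩ i
  have hwr : IsRegular t mk.T fun _ => w := isRegular_of_continuousOn continuousOn_const
  have hex : ∀ h : ℝ, ∃ Y : ℝ → Ω → ℝ, h ∈ Ioc 0 (mk.T - t) →
      IsWealth mk P ℱ W (splice (fun s _ => û s) (fun _ _ => w) t h) t 0 Y := fun h =>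
    (exists_isWealth hW 0 ht (isRegular_splice (c := t + h) hur hwr)).imp fun Y hY _ => hY
  choose Xh hXh using hex
  have hlim := tendsto_reward_quotient hW ρ hρ hfin hF lam β γ ht hû hwr tendsto_const_nhds hB hX
    hXh
  have h0 := hN.2 t ht 0 _ (h𝒱 (const_mem_deterministic hwM)) X hX Xh hXh
  rw [hlim.liminf_eq, ← EReal.coe_zero, EReal.coe_le_coe_iff] at h0
  have hsub : w - û t = ε • Pi.single k 1 := by rw [hw, add_sub_cancel_left]
  rw [hsub, volVec_smul, innerR_smul_left, innerR_smul_right] at h0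
  have hsum : ∑ i, (ε • Pi.single k 1 : Fin d → ℝ) i *
      firstOrder mk β γ F lam ρ.cashInd ρ.normalRisk.toReal û t (û t) i =
        ε * firstOrder mk β γ F lam ρ.cashInd ρ.normalRisk.toReal û t (û t) k := by
    rw [Finset.sum_eq_single k]
    · simp
    · intro i _ hi
      simp [hi]
    · simp
  rw [hsum] at h0
  linarith

/-- A solution of the first-order system is an equilibrium against deterministic controls: the
linear term of the derivative vanishes and the quadratic one has the right sign. -/
theorem isNash_of_firstOrder [IsProbabilityMeasure P]
    (hW : IsBrownianMotion P ℱ mk.R W) (ρ : RiskMeasure P ℱ mk.T)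
    (hρ : ρ.CashInvariant ∨ ρ.ShiftInvariant) (hfin : ρ.normalRisk ≠ ⊤) {F : ℝ → ℝ}
    (hF : Differentiable ℝ F) (hFmono : Monotone F) {lam : ℝ → ℝ}
    (hlam0 : ∀ t ∈ Icc 0 mk.T, 0 ≤ lam t) {β γ : ℝ} (hβ : 0 < β) (hγ : 0 < γ)
    {û : ℝ → Fin d → ℝ} (hû : ContinuousOn û (Icc 0 mk.T))
    (hûM : ∀ t ∈ Icc 0 mk.T, ∀ i, |û t i| ≤ mk.M) (hϱ : 0 ≤ ρ.normalRisk)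
    (hsol : ∀ t ∈ Ico 0 mk.T, 0 < volNorm mk û t ∧
      ∀ k, firstOrder mk β γ F lam ρ.cashInd ρ.normalRisk.toReal û t (û t) k = 0) :
    IsNashEquilibrium mk P ℱ W ρ (expTarget β γ) F lam (deterministicControls mk ℱ)
      (fun s _ => û s) := by
  have hne : Nonempty Ω := nonempty_of_isProbabilityMeasure P
  refine ⟨continuous_mem_admissible hû hûM, fun t ht x u hu X hX Xh hXh => ?_⟩
  obtain ⟨hadm, v, huv⟩ := hu
  obtain rfl : u = fun s _ => v s := funext fun s => funext fun ω => huv s ω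
  obtain ⟨ω⟩ := hne
  choose w hw using fun i => (hadm.2.1 ω i).2 t ht
  have hvw : Tendsto v (𝓝[>] t) (𝓝 w) := tendsto_pi_nhds.2 hw
  have hne : Nonempty Ω := ⟨ω⟩
  have hlim := tendsto_reward_quotient hW ρ hρ hfin hF lam β γ ht hû
    (isRegular_of_admissible hadm ht.1) hvw (hsol t ht).1 hX hXh
  rw [hlim.liminf_eq, ← EReal.coe_zero, EReal.coe_le_coe_iff]
  have hκ := curvature_pos (mk := mk) (c := ρ.cashInd) (û := û) hβ hγ hFmono
    (hlam0 t ⟨ht.1, ht.2.le⟩) (EReal.toReal_nonneg hϱ)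
  have hQ := innerR_self_nonneg mk.R_posDef (volVec mk t (w - û t))
  simp only [(hsol t ht).2, mul_zero, Finset.sum_const_zero, neg_zero, zero_add]
  positivity

end Equilibrium

end TimeConsistent

theorem theorem6p2 {Ω : Type*} [mΩ : MeasurableSpace Ω] {d : ℕ}
    (P : Measure Ω) [IsProbabilityMeasure P] (ℱ : Filtration ℝ mΩ)
    (mk : Market d) (W : ℝ → Ω → Fin d → ℝ) (hW : IsBrownianMotion P ℱ mk.R W)
    (ρ : RiskMeasure P ℱ mk.T) (hρ : ρ.CashInvariant ∨ ρ.ShiftInvariant)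
    (hρfin : ρ.normalRisk ≠ ⊤)
    (F : ℝ → ℝ) (hF1 : ContDiff ℝ 1 F) (hFmono : Monotone F) (hFconv : ConvexOn ℝ univ F)
    (lam : ℝ → ℝ) (hlam : ContinuousOn lam (Icc 0 mk.T)) (hlam0 : ∀ t ∈ Icc 0 mk.T, 0 ≤ lam t)
    (β γ : ℝ) (hβ : 0 < β) (hγ : 0 < γ)
    (û : ℝ → Fin d → ℝ) (hû : ContinuousOn û (Icc 0 mk.T))
    (hûM : ∀ t ∈ Icc 0 mk.T, ∀ i, |û t i| ≤ mk.M) :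
    -- an optimal control solves the equation, be it optimal against all admissible controls or
    -- only against a smaller class that contains the deterministic ones
    (∀ 𝒱 : Set (ℝ → Ω → Fin d → ℝ),
      deterministicControls mk ℱ ⊆ 𝒱 → 𝒱 ⊆ admissibleControls mk ℱ →
      IsNashEquilibrium mk P ℱ W ρ (expTarget β γ) F lam 𝒱 (fun s _ => û s) →
      ∀ t ∈ Ico 0 mk.T, 0 < volNorm mk û t → ∀ k, |û t k| < mk.M →
        firstOrder mk β γ F lam ρ.cashInd ρ.normalRisk.toReal û t (û t) k = 0) ∧
    -- given the control after time `t`, the equations at time `t` have at most one solution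
    (0 ≤ ρ.normalRisk → ∀ t ∈ Ico 0 mk.T, 0 < volNorm mk û t →
      ∀ w w' : Fin d → ℝ,
        (∀ k, firstOrder mk β γ F lam ρ.cashInd ρ.normalRisk.toReal û t w k = 0) →
        (∀ k, firstOrder mk β γ F lam ρ.cashInd ρ.normalRisk.toReal û t w' k = 0) → w = w') ∧
    -- a solution of the equations is an optimal control
    (0 ≤ ρ.normalRisk →
      (∀ t ∈ Ico 0 mk.T, 0 < volNorm mk û t ∧
        ∀ k, firstOrder mk β γ F lam ρ.cashInd ρ.normalRisk.toReal û t (û t) k = 0) →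
      IsNashEquilibrium mk P ℱ W ρ (expTarget β γ) F lam (deterministicControls mk ℱ)
        (fun s _ => û s)) := by 
  have hFd : Differentiable ℝ F := hF1.differentiable one_ne_zero
  refine ⟨fun 𝒱 h𝒱 _ hN t ht hB k hk => ?_, fun hϱ t ht _ w w' hw hw' => ?_, fun hϱ hsol => ?_⟩
  · exact firstOrder_eq_zero_of_isNash hW ρ hρ hρfin hFd lam β γ hû hûM h𝒱 hN ht hB hk
  · have ht' : t ∈ Icc 0 mk.T := ⟨ht.1, ht.2.le⟩
    exact firstOrder_unique hβ hγ hFmono ht' (hlam0 t ht') (EReal.toReal_nonneg hϱ) hw hw'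
  · exact isNash_of_firstOrder hW ρ hρ hρfin hFd hFmono hlam0 hβ hγ hû hûM hϱ hsol
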